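/- Let $a,b,c:\mathbf R\to\mathbf C$ be $C^\infty$ with $a(x)\neq 0$ for all $x$. For $h>0$ let $L_hf=-h^2af''-ihbf'+cf$, with semiclassical principal symbol $\sigma(u,\xi)=a(u)\xi^2+b(u)\xi+c(u)$; write $\sigma_1=\Re\sigma$, $\sigma_2=\Im\sigma$ and $$\Omega=\Big\{(u,\xi)\in\mathbf R^2:\ \frac{\partial\sigma_1}{\partial u}\frac{\partial\sigma_2}{\partial\xi}-\frac{\partial\sigma_1}{\partial\xi}\frac{\partial\sigma_2}{\partial u}>0\Big\}.$$ *Pseudo-eigenfunctions.* For $(u,\xi)\in\Omega$ put $$\psi_{-1}(s)=i\int_0^s\Big\{-\frac{b(u+v)}{2a(u+v)}+\sqrt{w(u,\xi,v)}\Big\}\,dv,\qquad w(u,\xi,v)=\frac{a(u)\xi^2+b(u)\xi+c(u)-c(u+v)}{a(u+v)}+\frac{b(u+v)^2}{4a(u+v)^2},$$ with the continuous branch of the square root that equals $\xi+b(u)/2a(u)$ at $v=0$, and for $m\ge 0$ let $\psi_m$ be determined by $\psi_m(0)=0$ and $$\psi_m'(s)=\frac{-a(u+s)\big(\psi_{m-1}''(s)+\sum_{k=0}^{m-1}\psi_k'(s)\psi_{m-1-k}'(s)\big)}{2a(u+s)\psi_{-1}'(s)+ib(u+s)}.$$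 Choose a radius $\delta=\delta(u,\xi)>0$, continuous on $\Omega$, and cutoffs $\chi_{u,\xi}\in C_c^\infty(\mathbf R)$, real-valued and jointly continuous in $(u,\xi,s)\in\Omega\times\mathbf R$, with $\chi_{u,\xi}(s)=1$ for $|s|\le\delta/2$ and $\chi_{u,\xi}(s)=0$ for $|s|\ge\delta$, where $\delta$ is so small that $w(u,\xi,s)\ne0$ for $|s|\le\delta$ and $\Re\psi_{-1}(s)<0$ for $0<|s|\le\delta$. Fix an integer $n\ge-1$ and let $$f_{h,u,\xi}(u+s)=h^{-1/4}\chi_{u,\xi}(s)\exp\Big(\sum_{m=-1}^n h^m\psi_m(s)\Big),\qquad e_{h,u,\xi}=f_{h,u,\xi}/\|f_{h,u,\xi}\|_{L^2(\mathbf R)}.$$ *Gaussians.* Let $$g_{h,u,\xi}(x)=h^{-1/4}\exp\{h^{-1}(i\xi(x-u)+k_{u,\xi}(x-u)^2/2)\},\qquad k_{u,\xi}=-i\,\frac{\partial\sigma}{\partial u}\Big\{\frac{\partial\sigma}{\partial\xi}\Big\}^{-1}.$$ **Theorem.** (i) If $h>0$ and $(u,\xi)\in\Omega$ then $g_{h,u,\xi}\in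 L^2(\mathbf R)$; put $e'_{h,u,\xi}=g_{h,u,\xi}/\|g_{h,u,\xi}\|_{L^2(\mathbf R)}$. (ii) Choices of $\delta$ and $\chi$ as above exist. For every such choice, every $n\geq -1$, every $h>0$ and every measurable $U\subseteq\Omega$, the formulas $$(E_{h,U}\phi)(x)=\int_U\phi(u,\xi)\,e_{h,u,\xi}(x)\,du\,d\xi,\qquad (E'_{h,U}\phi)(x)=\int_U\phi(u,\xi)\,e'_{h,u,\xi}(x)\,du\,d\xi,$$ whose integrals converge absolutely for almost every $x$, define bounded linear operators $L^1(U)\to L^2(\mathbf R)$. Write $E_h=E_{h,\Omega}$ and $E_h'=E'_{h,\Omega}$. (iii) If $\Omega\ne\emptyset$ then $\|E_h'\|=1$ for every $h>0$. (iv) $\lim_{h\to0+}\|E_h\phi-E_h'\phi\|=0$ for every $\phi\in L^1(\Omega)$. (v) $\lim_{h\to0+}\|E_{h,U}-E'_{h,U}\|=0$ for every compact $U\subseteq\Omega$. -/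

import Mathlib

open MeasureTheory Set Filter Topology
open scoped ContDiff

noncomputable section

namespace Semiclassical

/-- The continuous branch, starting from `z₀` at `v = 0`, of the square root of a nowhere vanishing
`C¹` function `W` with `W 0 = z₀ ^ 2`.  It is given by integrating the logarithmic derivative of `W`;
see `sqrtBranch_zero`, `sqrtBranch_continuousOn`, `sqrtBranch_sq` and `sqrtBranch_unique`. -/
def sqrtBranch (W : ℝ → ℂ) (z₀ : ℂ) (v : ℝ) : ℂ :=
  z₀ * Complex.exp ((∫ t in (0 : ℝ)..v, deriv W t / W t) / 2)

theorem sqrtBranch_zero (W : ℝ → ℂ) (z₀ : ℂ) : sqrtBranch W z₀ 0 = z₀ := by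
  simp [sqrtBranch]

theorem sqrtBranch_hasDerivAt_aux {W : ℝ → ℂ} (hW : ContDiff ℝ 1 W) {d : ℝ}
    (hne : ∀ v ∈ Icc (-d) d, W v ≠ 0) {v : ℝ} (hv : v ∈ Icc (-d) d) :
    HasDerivAt (fun v : ℝ => ∫ t in (0 : ℝ)..v, deriv W t / W t) (deriv W v / W v) v := by
  have hcd : Continuous (deriv W) := hW.continuous_deriv le_rfl
  have hca : ∀ t ∈ Icc (-d) d, ContinuousAt (fun t => deriv W t / W t) t := fun t ht =>
    hcd.continuousAt.div hW.continuous.continuousAt (hne t ht)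
  have h0 : (0 : ℝ) ∈ Icc (-d) d := by
    have := hv.1.trans hv.2
    constructor <;> linarith
  have hsub : uIcc 0 v ⊆ Icc (-d) d := (convex_Icc (-d) d).ordConnected.uIcc_subset h0 hv
  refine intervalIntegral.integral_hasDerivAt_right ?_ ?_ (hca v hv)
  · exact ContinuousOn.intervalIntegrable fun t ht => (hca t (hsub ht)).continuousWithinAt
  · exact (hcd.measurable.div hW.continuous.measurable).stronglyMeasurable
      |>.stronglyMeasurableAtFilter

theorem sqrtBranch_continuousOn {W : ℝ → ℂ} (hW : ContDiff ℝ 1 W) (z₀ : ℂ) {d : ℝ}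
    (hne : ∀ v ∈ Icc (-d) d, W v ≠ 0) : ContinuousOn (sqrtBranch W z₀) (Icc (-d) d) := by
  intro v hv
  have h := (sqrtBranch_hasDerivAt_aux hW hne hv).continuousAt
  have : ContinuousAt (sqrtBranch W z₀) v := by
    unfold sqrtBranch
    fun_prop
  exact this.continuousWithinAt

theorem sqrtBranch_sq {W : ℝ → ℂ} (hW : ContDiff ℝ 1 W) {z₀ : ℂ} (hz : z₀ ^ 2 = W 0) {d : ℝ}
    (hne : ∀ v ∈ Icc (-d) d, W v ≠ 0) {v : ℝ} (hv : v ∈ Icc (-d) d) :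
    sqrtBranch W z₀ v ^ 2 = W v := by
  set J : ℝ → ℂ := fun v => ∫ t in (0 : ℝ)..v, deriv W t / W t with hJ
  have h0 : (0 : ℝ) ∈ Icc (-d) d := by
    have := hv.1.trans hv.2
    constructor <;> linarith
  have hder : ∀ x ∈ Icc (-d) d,
      HasDerivWithinAt (fun x => W x * Complex.exp (-J x)) 0 (Icc (-d) d) x := by
    intro x hx
    have h1 : HasDerivAt J (deriv W x / W x) x := sqrtBranch_hasDerivAt_aux hW hne hx
    have h2 : HasDerivAt W (deriv W x) x :=
      ((hW.differentiable (by norm_num)) x).hasDerivAt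
    have h3 := h2.mul h1.neg.cexp
    have hW0 := hne x hx
    have h4 : deriv W x * Complex.exp (-J x)
        + W x * (Complex.exp (-J x) * -(deriv W x / W x)) = 0 := by
      field_simp
      ring
    rw [← h4]
    exact h3.hasDerivWithinAt
  have hconst := (convex_Icc (-d) d).norm_image_sub_le_of_norm_hasDerivWithin_le
    (C := 0) hder (fun x _ => by simp) h0 hv
  have hJ0 : J 0 = 0 := by simp [hJ]
  have heq : W v * Complex.exp (-J v) = W 0 := by
    have : ‖W v * Complex.exp (-J v) - W 0 * Complex.exp (-J 0)‖ ≤ 0 := by simpa using hconst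
    rw [hJ0] at this
    simpa [sub_eq_zero] using this
  have : sqrtBranch W z₀ v ^ 2 = z₀ ^ 2 * Complex.exp (J v) := by
    change (z₀ * Complex.exp (J v / 2)) ^ 2 = _
    rw [mul_pow, ← Complex.exp_nat_mul]
    congr 2
    push_cast
    ring
  rw [this, hz, ← heq, mul_assoc, ← Complex.exp_add]
  simp

theorem sqrtBranch_unique {W : ℝ → ℂ} (hW : ContDiff ℝ 1 W) {z₀ : ℂ} (hz : z₀ ^ 2 = W 0) {d : ℝ}
    (hne : ∀ v ∈ Icc (-d) d, W v ≠ 0) {r : ℝ → ℂ} (hr : ContinuousOn r (Icc (-d) d))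
    (hr0 : r 0 = z₀) (hr2 : ∀ v ∈ Icc (-d) d, r v ^ 2 = W v) {v : ℝ} (hv : v ∈ Icc (-d) d) :
    r v = sqrtBranch W z₀ v := by
  have h0 : (0 : ℝ) ∈ Icc (-d) d := by
    have := hv.1.trans hv.2
    constructor <;> linarith
  refine isPreconnected_Icc.eq_of_sq_eq hr (sqrtBranch_continuousOn hW z₀ hne) ?_ ?_ h0 ?_ hv
  · intro x hx
    simp [hr2 x hx, sqrtBranch_sq hW hz hne hx]
  · intro x hx hzero
    have := sqrtBranch_sq hW hz hne hx
    rw [hzero] at this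
    exact hne x hx (by simpa using this.symm)
  · rw [hr0, sqrtBranch_zero]

section Operator

variable (a b c : ℝ → ℂ)

/-- The semiclassical principal symbol of `L_h f = -h² a f'' - i h b f' + c f`. -/
def symbol (u ξ : ℝ) : ℂ := a u * (ξ : ℂ) ^ 2 + b u * ξ + c u

/-- `∂σ/∂u`. -/
def symbolDu (u ξ : ℝ) : ℂ := deriv (fun v : ℝ => symbol a b c v ξ) u

/-- `∂σ/∂ξ`. -/
def symbolDxi (u ξ : ℝ) : ℂ := deriv (fun η : ℝ => symbol a b c u η) ξ

/-- The Poisson bracket `{σ₁, σ₂}` of `σ₁ = Re σ` and `σ₂ = Im σ`. -/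
def bracket (u ξ : ℝ) : ℝ :=
  deriv (fun v : ℝ => (symbol a b c v ξ).re) u * deriv (fun η : ℝ => (symbol a b c u η).im) ξ
    - deriv (fun η : ℝ => (symbol a b c u η).re) ξ * deriv (fun v : ℝ => (symbol a b c v ξ).im) u

/-- `Ω = {(u, ξ) : {σ₁, σ₂} > 0}`. -/
def phaseRegion : Set (ℝ × ℝ) := {p | 0 < bracket a b c p.1 p.2}

/-- The function `w(u, ξ, v)` under the square root in the solution of the eikonal equation. -/
def eikonalW (p : ℝ × ℝ) (v : ℝ) : ℂ :=
  a p.1 * (p.2 : ℂ) ^ 2 / a (p.1 + v) + b p.1 * p.2 / a (p.1 + v)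
    + b (p.1 + v) ^ 2 / (4 * a (p.1 + v) ^ 2) + (c p.1 - c (p.1 + v)) / a (p.1 + v)

/-- The branch of `√w(u, ξ, ·)` which equals `ξ + b(u) / (2 a(u))` at `0`. -/
def eikonalRoot (p : ℝ × ℝ) : ℝ → ℂ :=
  sqrtBranch (eikonalW a b c p) (p.2 + b p.1 / (2 * a p.1))

/-- `wkbDeriv a b c p j` is the derivative `ψ'_{j-1}` of the `j`-th term (`j = 0, 1, 2, …`) of the
JWKB expansion `ψ = h⁻¹ ψ₋₁ + ψ₀ + h ψ₁ + …`.  The first one solves the eikonal equation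
`-a ψ₋₁'² - i b ψ₋₁' + c = σ(u, ξ)`; then `ψ_j'` makes the coefficient of `h ^ (j + 1)` in
`exp(-ψ) (L_h - σ(u, ξ)) exp(ψ)`, namely
`-a (ψ_{j-1}'' + ∑_{k + l = j - 1, k, l ≥ -1} ψ_k' ψ_l') - i b ψ_j'`, vanish. -/
def wkbDeriv (p : ℝ × ℝ) : ℕ → ℝ → ℂ
  | 0, s => Complex.I * (-(b (p.1 + s) / (2 * a (p.1 + s))) + eikonalRoot a b c p s)
  | j + 1, s =>
      -a (p.1 + s) * (deriv (fun t => wkbDeriv p j t) s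
          + ∑ i : Fin j, wkbDeriv p (i + 1) s * wkbDeriv p (j - i) s)
        / (2 * a (p.1 + s) * wkbDeriv p 0 s + Complex.I * b (p.1 + s))
  termination_by j => j
  decreasing_by all_goals omega

/-- `wkbTerm a b c p j s = ψ_{j-1}(s)`, normalized by `ψ_{j-1}(0) = 0`. -/
def wkbTerm (p : ℝ × ℝ) (j : ℕ) (s : ℝ) : ℂ := ∫ v in (0 : ℝ)..s, wkbDeriv a b c p j v

/-- The truncated JWKB phase `ψ = ∑_{m = -1}^n h^m ψ_m`, where `n = N - 1 ≥ -1`. -/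
def wkbPhase (N : ℕ) (h : ℝ) (p : ℝ × ℝ) (s : ℝ) : ℂ :=
  ∑ j ∈ Finset.range (N + 1), (h : ℂ) ^ ((j : ℤ) - 1) * wkbTerm a b c p j s

/-- Admissible choices of the cutoff radius `δ` and of the cutoff function `χ` used to localize the
JWKB functions at the points of `Ω`: `δ` is so small that on `[-δ, δ]` the function `w` has no zero
and `Re ψ₋₁(s) < 0` for `s ≠ 0`, and both choices depend continuously on the point of `Ω`. -/
structure IsCutoff (δ : ℝ × ℝ → ℝ) (χ : ℝ × ℝ → ℝ → ℝ) : Prop where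
  radius_pos : ∀ p ∈ phaseRegion a b c, 0 < δ p
  radius_continuousOn : ContinuousOn δ (phaseRegion a b c)
  w_ne_zero : ∀ p ∈ phaseRegion a b c, ∀ s : ℝ, |s| ≤ δ p → eikonalW a b c p s ≠ 0
  phase_neg : ∀ p ∈ phaseRegion a b c, ∀ s : ℝ, s ≠ 0 → |s| ≤ δ p → (wkbTerm a b c p 0 s).re < 0
  smooth : ∀ p ∈ phaseRegion a b c, ContDiff ℝ ∞ (χ p)
  continuousOn : ContinuousOn (fun q : (ℝ × ℝ) × ℝ => χ q.1 q.2) (phaseRegion a b c ×ˢ univ)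
  eq_one : ∀ p ∈ phaseRegion a b c, ∀ s : ℝ, |s| ≤ δ p / 2 → χ p s = 1
  eq_zero : ∀ p ∈ phaseRegion a b c, ∀ s : ℝ, δ p ≤ |s| → χ p s = 0

/-- The pseudo-eigenfunction `f_{h,u,ξ}(u + s) = h^{-1/4} χ(s) exp(ψ(s))`. -/
def pseudoEigenfunction (χ : ℝ × ℝ → ℝ → ℝ) (N : ℕ) (h : ℝ) (p : ℝ × ℝ) (x : ℝ) : ℂ :=
  ((h ^ (-(1 / 4) : ℝ) : ℝ) : ℂ) * (χ p (x - p.1) : ℂ)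
    * Complex.exp (wkbPhase a b c N h p (x - p.1))

/-- `k_{u,ξ} = -i (∂σ/∂u) (∂σ/∂ξ)⁻¹`. -/
def gaussianCoeff (p : ℝ × ℝ) : ℂ :=
  -Complex.I * symbolDu a b c p.1 p.2 * (symbolDxi a b c p.1 p.2)⁻¹

/-- `g_{h,u,ξ}(x) = h^{-1/4} exp(h⁻¹ (i ξ (x - u) + k_{u,ξ} (x - u)² / 2))`. -/
def gaussianState (h : ℝ) (p : ℝ × ℝ) (x : ℝ) : ℂ :=
  ((h ^ (-(1 / 4) : ℝ) : ℝ) : ℂ)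
    * Complex.exp ((h : ℂ)⁻¹ * (Complex.I * p.2 * ((x - p.1 : ℝ) : ℂ)
        + gaussianCoeff a b c p * ((x - p.1 : ℝ) : ℂ) ^ 2 / 2))

end Operator

/-- `f / ‖f‖`, with the norm of `L²(ℝ)`. -/
def normalized (f : ℝ → ℂ) (x : ℝ) : ℂ := f x / ((eLpNorm f 2 volume).toReal : ℂ)

/-- `T : L¹(U) → L²(ℝ)` is the integral transform `(T φ)(x) = ∫_U φ(u, ξ) e_{u,ξ}(x) du dξ`, the
integral being absolutely convergent for almost every `x`. -/
def IsIntegralTransform (U : Set (ℝ × ℝ)) (e : ℝ × ℝ → ℝ → ℂ)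
    (T : Lp ℂ 1 (volume.restrict U) →L[ℂ] Lp ℂ 2 (volume : Measure ℝ)) : Prop :=
  ∀ φ : Lp ℂ 1 (volume.restrict U), ∀ᵐ x : ℝ,
    IntegrableOn (fun p => φ p * e p x) U ∧ T φ x = ∫ p in U, φ p * e p x

theorem IsIntegralTransform.unique {U : Set (ℝ × ℝ)} {e : ℝ × ℝ → ℝ → ℂ}
    {T T' : Lp ℂ 1 (volume.restrict U) →L[ℂ] Lp ℂ 2 (volume : Measure ℝ)}
    (h : IsIntegralTransform U e T) (h' : IsIntegralTransform U e T') : T = T' := by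
  ext1 φ
  refine Lp.ext ?_
  filter_upwards [h φ, h' φ] with x hx hx'
  rw [hx.2, hx'.2]

end Semiclassical

end

noncomputable section

namespace Semiclassical

/-! ### Cauchy–Schwarz bounds for kernels depending on a parameter. -/

section Kernel

open scoped ENNReal

/-! For any kernel, Cauchy–Schwarz with weight `|φ|` and Tonelli give `‖∫ φ e_p‖² ≤ ‖φ‖₁ ∫ |φ(p)|
‖e_p‖² dp`. Normalized kernels therefore define contractions from `L¹` to `L²`, and comparing two
transforms reduces to bounding `‖e_p - e'_p‖`. A bound uniform on compact sets gives (v).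
Convergence at each `p`, with the trivial bound 2, gives (iv) by dominated convergence. For (iii),
`p ↦ e'_p` is continuous into `L²`, so the transform of the indicator of a small ball is nearly its
mass times a unit vector.

The bound is `‖e_p - e'_p‖ ≤ C √h` on compact sets (`exists_eLpNorm_normalized_sub_le`).
Differentiating the eikonal equation at `s = 0` gives `ψ₋₁''(0) = k` (`deriv_wkbDeriv_zero`). Hence
the Gaussian exponent is the second-order Taylor polynomial of `h⁻¹ψ₋₁`; the error is `O(h⁻¹|s|³)`,
and the later terms `ψ_m` contribute `O(|s|)`. The bracket condition says exactly that `Re k < 0`,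
and compactness turns `Re ψ₋₁ < 0` into `Re ψ₋₁ ≤ -κ s²` on the whole support of the cutoff. With `s
= √h t` the pointwise difference is at most `√h (t + t³) exp(-κ t²)`, up to a constant and the
prefactor `h^{-1/4}` (`exists_norm_pseudoEigenfunction_sub_le`). The Gaussians have `L²` norm
independent of `h`, so normalizing costs only a constant. -/

theorem lintegral_mul_sq_le {α : Type*} [MeasurableSpace α] {μ : Measure α} {f g : α → ℝ≥0∞}
    (hf : AEMeasurable f μ) (hg : AEMeasurable g μ) :
    (∫⁻ x, f x * g x ∂μ) ^ 2 ≤ (∫⁻ x, f x ∂μ) * ∫⁻ x, f x * g x ^ 2 ∂μ := by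
  -- The weight is split as `f = f^{1/2} · f^{1/2}`, one half going to each factor.
  have h := ENNReal.lintegral_mul_le_Lp_mul_Lq μ Real.HolderConjugate.two_two
    (f := fun x => f x ^ (1 / 2 : ℝ)) (g := fun x => f x ^ (1 / 2 : ℝ) * g x)
    (hf.pow_const _) ((hf.pow_const _).mul hg)
  have e1 : ∀ x, (f x ^ (1 / 2 : ℝ)) ^ (2 : ℝ) = f x := fun x => by
    rw [← ENNReal.rpow_mul]; norm_num
  have e2 : ∀ x, f x ^ (1 / 2 : ℝ) * f x ^ (1 / 2 : ℝ) = f x := fun x => by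
    rw [← ENNReal.rpow_add_of_nonneg _ _ (by norm_num) (by norm_num)]; norm_num
  simp only [Pi.mul_apply, ← mul_assoc, e2, ENNReal.mul_rpow_of_nonneg _ _ zero_le_two, e1] at h
  calc (∫⁻ x, f x * g x ∂μ) ^ 2
      ≤ ((∫⁻ x, f x ∂μ) ^ (1 / 2 : ℝ) * (∫⁻ x, f x * g x ^ (2 : ℝ) ∂μ) ^ (1 / 2 : ℝ)) ^ 2 := by
        gcongr
    _ = _ := by
        rw [mul_pow]
        simp only [← ENNReal.rpow_natCast, ← ENNReal.rpow_mul]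
        norm_num

theorem eLpNorm_two_sq {α : Type*} [MeasurableSpace α] (μ : Measure α) (f : α → ℂ) :
    eLpNorm f 2 μ ^ 2 = ∫⁻ x, ‖f x‖ₑ ^ 2 ∂μ := by
  rw [eLpNorm_eq_lintegral_rpow_enorm_toReal (by norm_num) (by norm_num), ← ENNReal.rpow_natCast,
    ← ENNReal.rpow_mul]
  norm_num

variable {α : Type*} [MeasurableSpace α] {μ : Measure α}

theorem aemeasurable_eLpNorm_kernel {e : α → ℝ → ℂ}
    (he : AEStronglyMeasurable (Function.uncurry e) (μ.prod volume)) :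
    AEMeasurable (fun p => eLpNorm (e p) 2 volume) μ := by
  have h : ∀ p, eLpNorm (e p) 2 volume = (∫⁻ x, ‖e p x‖ₑ ^ (2 : ℝ)) ^ (1 / 2 : ℝ) := fun p => by
    rw [eLpNorm_eq_lintegral_rpow_enorm_toReal (by norm_num) (by norm_num)]
    norm_num
  simp only [h]
  exact (AEMeasurable.lintegral_prod_right' (he.enorm.pow_const _)).pow_const _

/-- Cauchy–Schwarz in `p` for fixed `x`, then Tonelli. Keeping the `L²` norm of `e p` under the
integral, rather than its supremum, is what later permits dominated convergence. -/
theorem lintegral_sq_kernel_le [SFinite μ] {φ : α → ℂ} {e : α → ℝ → ℂ} (hφ : AEStronglyMeasurable φ μ)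
    (he : AEStronglyMeasurable (Function.uncurry e) (μ.prod volume)) :
    ∫⁻ x, (∫⁻ p, ‖φ p * e p x‖ₑ ∂μ) ^ 2
      ≤ (∫⁻ p, ‖φ p‖ₑ ∂μ) * ∫⁻ p, ‖φ p‖ₑ * eLpNorm (e p) 2 volume ^ 2 ∂μ := by
  have hx : ∀ᵐ x : ℝ, AEStronglyMeasurable (fun p => e p x) μ := he.prodMk_right
  calc ∫⁻ x, (∫⁻ p, ‖φ p * e p x‖ₑ ∂μ) ^ 2
      ≤ ∫⁻ x, (∫⁻ p, ‖φ p‖ₑ ∂μ) * ∫⁻ p, ‖φ p‖ₑ * ‖e p x‖ₑ ^ 2 ∂μ := by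
        refine lintegral_mono_ae ?_
        filter_upwards [hx] with x hx
        simp only [enorm_mul]
        exact lintegral_mul_sq_le hφ.enorm hx.enorm
    _ = (∫⁻ p, ‖φ p‖ₑ ∂μ) * ∫⁻ x, ∫⁻ p, ‖φ p‖ₑ * ‖e p x‖ₑ ^ 2 ∂μ := by
        refine lintegral_const_mul'' _ (AEMeasurable.lintegral_prod_left' (μ := μ) (ν := volume)
          (f := fun q => ‖φ q.1‖ₑ * ‖e q.1 q.2‖ₑ ^ 2) ?_)
        exact hφ.enorm.comp_fst.mul (he.enorm.pow_const 2)
    _ = (∫⁻ p, ‖φ p‖ₑ ∂μ) * ∫⁻ p, (∫⁻ x, ‖φ p‖ₑ * ‖e p x‖ₑ ^ 2) ∂μ := by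
        rw [lintegral_lintegral_swap]
        exact (hφ.enorm.comp_fst.mul (he.enorm.pow_const 2)).prod_swap
    _ = _ := by
        congr 1
        refine lintegral_congr_ae ?_
        filter_upwards [he.prodMk_left] with p hp
        rw [eLpNorm_two_sq]
        exact lintegral_const_mul'' _ (hp.enorm.pow_const 2)

end Kernel

/-! ### Integral transforms from `L¹(U)` to `L²(ℝ)`. -/

section Transform

open scoped ENNReal

variable {U : Set (ℝ × ℝ)} {e : ℝ × ℝ → ℝ → ℂ}

theorem enorm_sq_kernel_integral_le (φ : Lp ℂ 1 (volume.restrict U))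
    (he : AEStronglyMeasurable (Function.uncurry e) ((volume.restrict U).prod volume)) :
    ∫⁻ x, (∫⁻ p in U, ‖φ p * e p x‖ₑ) ^ 2
      ≤ ‖φ‖ₑ * ∫⁻ p in U, ‖φ p‖ₑ * eLpNorm (e p) 2 volume ^ 2 := by
  refine (lintegral_sq_kernel_le (Lp.aestronglyMeasurable φ) he).trans_eq ?_
  rw [Lp.enorm_def, eLpNorm_one_eq_lintegral_enorm]

theorem enorm_sq_kernel_integral_le_of_le (φ : Lp ℂ 1 (volume.restrict U))
    (he : AEStronglyMeasurable (Function.uncurry e) ((volume.restrict U).prod volume))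
    {M : ℝ≥0∞} (hM : ∀ᵐ p ∂(volume.restrict U), eLpNorm (e p) 2 volume ≤ M) :
    ∫⁻ x, (∫⁻ p in U, ‖φ p * e p x‖ₑ) ^ 2 ≤ (M * ‖φ‖ₑ) ^ 2 := by
  refine (enorm_sq_kernel_integral_le φ he).trans ?_
  calc ‖φ‖ₑ * ∫⁻ p in U, ‖φ p‖ₑ * eLpNorm (e p) 2 volume ^ 2
      ≤ ‖φ‖ₑ * ∫⁻ p in U, ‖φ p‖ₑ * M ^ 2 := by
        gcongr ‖φ‖ₑ * ?_
        refine lintegral_mono_ae ?_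
        filter_upwards [hM] with p hp
        gcongr
    _ = (M * ‖φ‖ₑ) ^ 2 := by
        rw [lintegral_mul_const'' _ (Lp.aestronglyMeasurable φ).enorm,
          ← eLpNorm_one_eq_lintegral_enorm, ← Lp.enorm_def]
        ring

theorem integrableOn_kernel_ae (φ : Lp ℂ 1 (volume.restrict U))
    (he : AEStronglyMeasurable (Function.uncurry e) ((volume.restrict U).prod volume))
    {M : ℝ≥0∞} (hMt : M ≠ ⊤) (hM : ∀ᵐ p ∂(volume.restrict U), eLpNorm (e p) 2 volume ≤ M) :
    ∀ᵐ x : ℝ, IntegrableOn (fun p => φ p * e p x) U := by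
  have hfin : ∫⁻ x, (∫⁻ p in U, ‖φ p * e p x‖ₑ) ^ 2 ≠ ⊤ :=
    ((enorm_sq_kernel_integral_le_of_le φ he hM).trans_lt
      (ENNReal.pow_lt_top (ENNReal.mul_lt_top hMt.lt_top enorm_lt_top))).ne
  have hmeas : AEStronglyMeasurable (fun q : (ℝ × ℝ) × ℝ => φ q.1 * e q.1 q.2)
      ((volume.restrict U).prod volume) := (Lp.aestronglyMeasurable φ).comp_fst.mul he
  have h2 : AEMeasurable (fun x => (∫⁻ p in U, ‖φ p * e p x‖ₑ) ^ 2) :=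
    (AEMeasurable.lintegral_prod_left' hmeas.enorm).pow_const 2
  filter_upwards [ae_lt_top' h2 hfin, hmeas.prodMk_right] with x hx hxm
  refine ⟨hxm, ?_⟩
  rw [hasFiniteIntegral_iff_enorm]
  by_contra hcon
  rw [not_lt, top_le_iff] at hcon
  exact absurd hx (by rw [hcon]; simp)

theorem memLp_kernel_integral (φ : Lp ℂ 1 (volume.restrict U))
    (he : AEStronglyMeasurable (Function.uncurry e) ((volume.restrict U).prod volume))
    {M : ℝ≥0∞} (hMt : M ≠ ⊤) (hM : ∀ᵐ p ∂(volume.restrict U), eLpNorm (e p) 2 volume ≤ M) :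
    MemLp (fun x => ∫ p in U, φ p * e p x) 2 volume := by
  have hmeas : AEStronglyMeasurable (fun q : (ℝ × ℝ) × ℝ => φ q.1 * e q.1 q.2)
      ((volume.restrict U).prod volume) := (Lp.aestronglyMeasurable φ).comp_fst.mul he
  refine ⟨hmeas.prod_swap.integral_prod_right', ?_⟩
  have h : eLpNorm (fun x => ∫ p in U, φ p * e p x) 2 volume ^ 2 ≤ (M * ‖φ‖ₑ) ^ 2 := by
    rw [eLpNorm_two_sq]
    refine le_trans (lintegral_mono fun x => ?_) (enorm_sq_kernel_integral_le_of_le φ he hM)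
    gcongr
    exact enorm_integral_le_lintegral_enorm _
  refine lt_of_le_of_lt ?_ (ENNReal.mul_lt_top hMt.lt_top (enorm_lt_top (x := φ)))
  simpa using (ENNReal.pow_le_pow_left_iff two_ne_zero).1 h

theorem IsIntegralTransform.enorm_sq_le
    {T : Lp ℂ 1 (volume.restrict U) →L[ℂ] Lp ℂ 2 (volume : Measure ℝ)}
    (hT : IsIntegralTransform U e T)
    (he : AEStronglyMeasurable (Function.uncurry e) ((volume.restrict U).prod volume))
    (φ : Lp ℂ 1 (volume.restrict U)) :
    ‖T φ‖ₑ ^ 2 ≤ ‖φ‖ₑ * ∫⁻ p in U, ‖φ p‖ₑ * eLpNorm (e p) 2 volume ^ 2 := by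
  refine le_trans ?_ (enorm_sq_kernel_integral_le φ he)
  rw [Lp.enorm_def, eLpNorm_two_sq]
  refine lintegral_mono_ae ?_
  filter_upwards [hT φ] with x hx
  rw [hx.2]
  gcongr
  exact enorm_integral_le_lintegral_enorm _

theorem IsIntegralTransform.norm_le
    {T : Lp ℂ 1 (volume.restrict U) →L[ℂ] Lp ℂ 2 (volume : Measure ℝ)}
    (hT : IsIntegralTransform U e T)
    (he : AEStronglyMeasurable (Function.uncurry e) ((volume.restrict U).prod volume))
    {M : ℝ} (hM0 : 0 ≤ M)
    (hM : ∀ᵐ p ∂(volume.restrict U), eLpNorm (e p) 2 volume ≤ ENNReal.ofReal M) : ‖T‖ ≤ M := by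
  refine T.opNorm_le_bound hM0 fun φ => ?_
  have h : ‖T φ‖ₑ ^ 2 ≤ (ENNReal.ofReal M * ‖φ‖ₑ) ^ 2 := by
    refine le_trans ?_ (enorm_sq_kernel_integral_le_of_le φ he hM)
    rw [Lp.enorm_def, eLpNorm_two_sq]
    refine lintegral_mono_ae ?_
    filter_upwards [hT φ] with x hx
    rw [hx.2]
    gcongr
    exact enorm_integral_le_lintegral_enorm _
  have h' := (ENNReal.pow_le_pow_left_iff two_ne_zero).1 h
  rw [← ofReal_norm, ← ofReal_norm, ← ENNReal.ofReal_mul hM0] at h'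
  exact (ENNReal.ofReal_le_ofReal_iff (by positivity)).1 h'

theorem IsIntegralTransform.sub {e' : ℝ × ℝ → ℝ → ℂ}
    {T T' : Lp ℂ 1 (volume.restrict U) →L[ℂ] Lp ℂ 2 (volume : Measure ℝ)}
    (hT : IsIntegralTransform U e T) (hT' : IsIntegralTransform U e' T') :
    IsIntegralTransform U (fun p x => e p x - e' p x) (T - T') := by
  intro φ
  filter_upwards [hT φ, hT' φ, Lp.coeFn_sub (T φ) (T' φ)] with x hx hx' hs
  have heq : (fun p => φ p * (e p x - e' p x)) = (fun p => φ p * e p x) - fun p => φ p * e' p x := by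
    ext p; simp [mul_sub]
  rw [heq]
  refine ⟨hx.1.sub hx'.1, ?_⟩
  change (T φ - T' φ : Lp ℂ 2 (volume : Measure ℝ)) x = _
  rw [hs, Pi.sub_apply, hx.2, hx'.2, ← integral_sub hx.1 hx'.1]
  rfl

theorem exists_isIntegralTransform
    (he : AEStronglyMeasurable (Function.uncurry e) ((volume.restrict U).prod volume))
    {M : ℝ} (hM : ∀ᵐ p ∂(volume.restrict U), eLpNorm (e p) 2 volume ≤ ENNReal.ofReal M) :
    ∃ T : Lp ℂ 1 (volume.restrict U) →L[ℂ] Lp ℂ 2 (volume : Measure ℝ),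
      IsIntegralTransform U e T := by
  have hmem := fun φ => memLp_kernel_integral φ he ENNReal.ofReal_ne_top hM
  have hint := fun φ => integrableOn_kernel_ae φ he ENNReal.ofReal_ne_top hM
  let T₀ : Lp ℂ 1 (volume.restrict U) →ₗ[ℂ] Lp ℂ 2 (volume : Measure ℝ) :=
    { toFun := fun φ => (hmem φ).toLp _
      map_add' := fun φ ψ => by
        rw [← MemLp.toLp_add]
        refine MemLp.toLp_congr _ _ ?_
        filter_upwards [hint φ, hint ψ] with x h1 h2
        rw [Pi.add_apply, ← integral_add h1 h2]
        refine integral_congr_ae ?_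
        filter_upwards [Lp.coeFn_add φ ψ] with p hp
        rw [hp, Pi.add_apply, add_mul]
      map_smul' := fun r φ => by
        rw [RingHom.id_apply, ← MemLp.toLp_const_smul]
        refine MemLp.toLp_congr _ _ (Eventually.of_forall fun x => ?_)
        rw [Pi.smul_apply, ← integral_smul]
        refine integral_congr_ae ?_
        filter_upwards [Lp.coeFn_smul r φ] with p hp
        rw [hp, Pi.smul_apply, smul_eq_mul, smul_eq_mul, mul_assoc] }
  have hT₀ : ∀ φ, ∀ᵐ x : ℝ, T₀ φ x = ∫ p in U, φ p * e p x := fun φ => (hmem φ).coeFn_toLp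
  -- `M` has no assumed sign; since `ENNReal.ofReal` truncates at 0, `max M 0` is the same bound.
  refine ⟨T₀.mkContinuous (max M 0) fun φ => ?_, fun φ => ?_⟩
  · have h : ‖T₀ φ‖ₑ ^ 2 ≤ (ENNReal.ofReal M * ‖φ‖ₑ) ^ 2 := by
      refine le_trans ?_ (enorm_sq_kernel_integral_le_of_le φ he hM)
      rw [Lp.enorm_def, eLpNorm_two_sq]
      refine lintegral_mono_ae ?_
      filter_upwards [hT₀ φ] with x hx
      rw [hx]
      gcongr
      exact enorm_integral_le_lintegral_enorm _
    have h' := (ENNReal.pow_le_pow_left_iff two_ne_zero).1 h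
    have h3 : ENNReal.ofReal M = ENNReal.ofReal (max M 0) := by simp [ENNReal.ofReal_max]
    rw [h3, ← ofReal_norm, ← ofReal_norm, ← ENNReal.ofReal_mul (le_max_right _ _)] at h'
    exact (ENNReal.ofReal_le_ofReal_iff (by positivity)).1 h'
  · filter_upwards [hT₀ φ, hint φ] with x h1 h2 using ⟨h2, h1⟩

end Transform

/-! ### Normalization in `L²`. -/

section Normalized

open scoped ENNReal

theorem eLpNorm_normalized {f : ℝ → ℂ} :
    eLpNorm (normalized f) 2 volume
      = ENNReal.ofReal (eLpNorm f 2 volume).toReal⁻¹ * eLpNorm f 2 volume := by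
  have h : normalized f = ((eLpNorm f 2 volume).toReal⁻¹ : ℝ) • f := by
    ext x
    simp [normalized, div_eq_inv_mul]
  rw [h, eLpNorm_const_smul, Real.enorm_eq_ofReal (by positivity)]

/-- No hypothesis on `f` is needed: if the norm is 0 or `⊤`, its `toReal` is 0 and division by zero
makes `normalized f` vanish. Boundedness of the transforms thus requires no norm computation. -/
theorem eLpNorm_normalized_le_one (f : ℝ → ℂ) : eLpNorm (normalized f) 2 volume ≤ 1 := by
  rw [eLpNorm_normalized]
  by_cases h0 : eLpNorm f 2 volume = 0
  · simp [h0]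
  by_cases ht : eLpNorm f 2 volume = ⊤
  · simp [ht]
  rw [ENNReal.ofReal_inv_of_pos (ENNReal.toReal_pos h0 ht), ENNReal.ofReal_toReal ht,
    ENNReal.inv_mul_cancel h0 ht]

theorem eLpNorm_normalized_eq_one {f : ℝ → ℂ} (h0 : eLpNorm f 2 volume ≠ 0)
    (ht : eLpNorm f 2 volume ≠ ⊤) : eLpNorm (normalized f) 2 volume = 1 := by
  rw [eLpNorm_normalized, ENNReal.ofReal_inv_of_pos (ENNReal.toReal_pos h0 ht),
    ENNReal.ofReal_toReal ht, ENNReal.inv_mul_cancel h0 ht]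

/-- Passing through `‖y‖⁻¹ • x` costs `‖x - y‖ / ‖y‖` twice. Only `y` must be nonzero, so a lower
bound is needed for the Gaussian alone. -/
theorem norm_inv_norm_smul_sub_le {E : Type*} [NormedAddCommGroup E] [NormedSpace ℝ E] (x y : E)
    (hy : y ≠ 0) : ‖‖x‖⁻¹ • x - ‖y‖⁻¹ • y‖ ≤ 2 * ‖x - y‖ / ‖y‖ := by
  have hy' : 0 < ‖y‖ := norm_pos_iff.2 hy
  have h1 : ‖‖x‖⁻¹ • x - ‖y‖⁻¹ • x‖ ≤ ‖x - y‖ / ‖y‖ := by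
    rcases eq_or_ne x 0 with rfl | hx
    · simp; positivity
    have hx' : 0 < ‖x‖ := norm_pos_iff.2 hx
    rw [← sub_smul, norm_smul, Real.norm_eq_abs]
    have h2 : ‖x‖⁻¹ - ‖y‖⁻¹ = (‖y‖ - ‖x‖) / (‖x‖ * ‖y‖) := by field_simp
    rw [h2, abs_div, abs_of_pos (mul_pos hx' hy'), div_mul_eq_mul_div, mul_comm ‖x‖ ‖y‖,
      mul_div_mul_right _ _ hx'.ne']
    gcongr
    rw [abs_sub_comm]
    exact abs_norm_sub_norm_le x y
  have h3 : ‖‖y‖⁻¹ • x - ‖y‖⁻¹ • y‖ = ‖x - y‖ / ‖y‖ := by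
    rw [← smul_sub, norm_smul, norm_inv, norm_norm, inv_mul_eq_div]
  calc _ ≤ ‖‖x‖⁻¹ • x - ‖y‖⁻¹ • x‖ + ‖‖y‖⁻¹ • x - ‖y‖⁻¹ • y‖ := norm_sub_le_norm_sub_add_norm_sub ..
    _ ≤ ‖x - y‖ / ‖y‖ + ‖x - y‖ / ‖y‖ := add_le_add h1 h3.le
    _ = _ := by ring

theorem eLpNorm_normalized_sub_le {f g : ℝ → ℂ} (hf : MemLp f 2 volume) (hg : MemLp g 2 volume)
    (hg0 : eLpNorm g 2 volume ≠ 0) :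
    eLpNorm (fun x => normalized f x - normalized g x) 2 volume
      ≤ ENNReal.ofReal (2 * (eLpNorm (f - g) 2 volume).toReal / (eLpNorm g 2 volume).toReal) := by
  have hn : ∀ {k : ℝ → ℂ}, normalized k = ((eLpNorm k 2 volume).toReal⁻¹ : ℝ) • k := by
    intro k; ext x; simp [normalized, div_eq_inv_mul]
  have h := norm_inv_norm_smul_sub_le (hf.toLp f) (hg.toLp g) (by
    intro h0
    rw [← norm_eq_zero, Lp.norm_toLp, ENNReal.toReal_eq_zero_iff] at h0
    exact h0.elim hg0 hg.2.ne)
  rw [← MemLp.toLp_sub, ← MemLp.toLp_const_smul, ← MemLp.toLp_const_smul, ← MemLp.toLp_sub,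
    Lp.norm_toLp, Lp.norm_toLp, Lp.norm_toLp, Lp.norm_toLp, ← hn, ← hn] at h
  have hm : MemLp (normalized f - normalized g) 2 volume := by
    rw [hn, hn]; exact (hf.const_smul _).sub (hg.const_smul _)
  change eLpNorm (normalized f - normalized g) 2 volume ≤ _
  rw [← ENNReal.ofReal_toReal hm.2.ne]
  exact ENNReal.ofReal_le_ofReal h

end Normalized

/-! ### Joint regularity of primitives, derivatives and square roots. -/

section Smoothness

/-- Rescaling to the fixed interval `[0, 1]` moves the endpoint into the integrand, and `projIcc`
keeps the argument inside `D` for every real `t`. -/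
theorem continuousOn_primitive {D : Set ((ℝ × ℝ) × ℝ)} (hDo : IsOpen D)
    (hD : ∀ q ∈ D, ∀ t ∈ Icc (0 : ℝ) 1, (q.1, t * q.2) ∈ D) {F : ℝ × ℝ → ℝ → ℂ}
    (hF : ContinuousOn (fun q : (ℝ × ℝ) × ℝ => F q.1 q.2) D) :
    ContinuousOn (fun q : (ℝ × ℝ) × ℝ => ∫ t in (0 : ℝ)..q.2, F q.1 t) D := by
  have hcv : ∀ q : (ℝ × ℝ) × ℝ, ∫ t in (0 : ℝ)..q.2, F q.1 t
      = q.2 • ∫ t in (0 : ℝ)..1, F q.1 (t * q.2) := fun q => by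
    rw [intervalIntegral.smul_integral_comp_mul_right (fun t => F q.1 t)]
    simp
  rw [continuousOn_iff_continuous_domRestrict]
  have heq : (D.domRestrict fun q : (ℝ × ℝ) × ℝ => ∫ t in (0 : ℝ)..q.2, F q.1 t)
      = fun q : D => q.1.2 • ∫ t in (0 : ℝ)..1,
        F q.1.1 ((projIcc (0 : ℝ) 1 zero_le_one t : ℝ) * q.1.2) := by
    ext q
    rw [domRestrict_apply, hcv]
    congr 1
    refine intervalIntegral.integral_congr fun t ht => ?_
    rw [uIcc_of_le zero_le_one] at ht
    rw [projIcc_of_mem zero_le_one ht]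
  rw [heq]
  have : LocallyCompactSpace D := hDo.locallyCompactSpace
  refine (continuous_subtype_val.snd).smul ?_
  refine intervalIntegral.continuous_parametric_intervalIntegral_of_continuous' ?_ 0 1
  have hmap : Continuous fun r : D × ℝ =>
      ((r.1.1.1, (projIcc (0 : ℝ) 1 zero_le_one r.2 : ℝ) * r.1.1.2) : (ℝ × ℝ) × ℝ) := by
    fun_prop
  exact hF.comp_continuous hmap fun r => hD _ r.1.2 _ (projIcc (0 : ℝ) 1 zero_le_one r.2).2

theorem hasDerivAt_of_contDiffOn {D : Set ((ℝ × ℝ) × ℝ)} (hDo : IsOpen D) {G : ℝ × ℝ → ℝ → ℂ}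
    (hG : ContDiffOn ℝ ∞ (fun q : (ℝ × ℝ) × ℝ => G q.1 q.2) D) {q : (ℝ × ℝ) × ℝ} (hq : q ∈ D) :
    HasDerivAt (G q.1) (fderiv ℝ (fun q : (ℝ × ℝ) × ℝ => G q.1 q.2) q (0, 1)) q.2 := by
  have h1 : HasFDerivAt (fun q : (ℝ × ℝ) × ℝ => G q.1 q.2)
      (fderiv ℝ (fun q : (ℝ × ℝ) × ℝ => G q.1 q.2) q) (q.1, q.2) :=
    ((hG.contDiffAt (hDo.mem_nhds hq)).differentiableAt (by norm_num)).hasFDerivAt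
  have h2 : HasDerivAt (fun s : ℝ => ((q.1, s) : (ℝ × ℝ) × ℝ)) (0, 1) q.2 :=
    (hasDerivAt_const _ _).prodMk (hasDerivAt_id _)
  exact h1.comp_hasDerivAt q.2 h2

theorem contDiffOn_deriv_snd {D : Set ((ℝ × ℝ) × ℝ)} (hDo : IsOpen D) {G : ℝ × ℝ → ℝ → ℂ}
    (hG : ContDiffOn ℝ ∞ (fun q : (ℝ × ℝ) × ℝ => G q.1 q.2) D) :
    ContDiffOn ℝ ∞ (fun q : (ℝ × ℝ) × ℝ => deriv (G q.1) q.2) D := by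
  have h := hG.fderiv_of_isOpen (m := ∞) hDo (by simp)
  exact (h.clm_apply contDiffOn_const).congr fun q hq => (hasDerivAt_of_contDiffOn hDo hG hq).deriv

theorem contDiffOn_div {E : Type*} [NormedAddCommGroup E] [NormedSpace ℝ E] {f g : E → ℂ}
    {s : Set E} (hf : ContDiffOn ℝ ∞ f s) (hg : ContDiffOn ℝ ∞ g s) (h0 : ∀ x ∈ s, g x ≠ 0) :
    ContDiffOn ℝ ∞ (fun x => f x / g x) s := by
  simp only [div_eq_mul_inv]
  exact hf.mul (hg.inv h0)

theorem contDiff_div {E : Type*} [NormedAddCommGroup E] [NormedSpace ℝ E] {f g : E → ℂ}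
    (hf : ContDiff ℝ ∞ f) (hg : ContDiff ℝ ∞ g) (h0 : ∀ x, g x ≠ 0) :
    ContDiff ℝ ∞ (fun x => f x / g x) :=
  contDiffOn_univ.1 (contDiffOn_div hf.contDiffOn hg.contDiffOn fun x _ => h0 x)

/-- Near `x` the quotient `w y / w x` is close to 1, so `r x * exp (log (w y / w x) / 2)` is a
smooth root of `w`; continuity of `r` excludes the opposite sign. -/
theorem contDiffAt_of_sq {E : Type*} [NormedAddCommGroup E] [NormedSpace ℝ E] {r w : E → ℂ} {x : E}
    (hr : ContinuousAt r x) (hw : ContDiffAt ℝ ∞ w x) (hrw : ∀ᶠ y in 𝓝 x, r y ^ 2 = w y)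
    (hx : w x ≠ 0) : ContDiffAt ℝ ∞ r x := by
  have hrx : r x ≠ 0 := fun h => hx (by rw [← hrw.self_of_nhds, h]; simp)
  have hq : ContDiffAt ℝ ∞ (fun y => Complex.log (w y / w x)) x := by
    have h1 : ContDiffAt ℝ ∞ (fun y => w y / w x) x := hw.div_const _
    have h2 : ContDiffAt ℝ ∞ Complex.log (w x / w x) := by
      rw [div_self hx]
      exact ((Complex.contDiffAt_log (n := ∞) (by simp)).restrict_scalars ℝ)
    exact ContDiffAt.comp x h2 h1
  have hρ : ContDiffAt ℝ ∞ (fun y => r x * Complex.exp (Complex.log (w y / w x) / 2)) x :=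
    contDiffAt_const.mul (hq.div_const _).cexp
  refine hρ.congr_of_eventuallyEq ?_
  have hc : ContinuousAt (fun y => r y - -(r x * Complex.exp (Complex.log (w y / w x) / 2))) x :=
    hr.sub hρ.continuousAt.neg
  have hne : (fun y => r y - -(r x * Complex.exp (Complex.log (w y / w x) / 2))) x ≠ 0 := by
    simp [div_self hx, ← two_mul, hrx]
  have hwne : ∀ᶠ y in 𝓝 x, w y ≠ 0 := hw.continuousAt.eventually_ne hx
  filter_upwards [hrw, hc.eventually_ne hne, hwne] with y h1 h2 h3
  have h4 : (r x * Complex.exp (Complex.log (w y / w x) / 2)) ^ 2 = w y := by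
    rw [mul_pow, ← Complex.exp_nat_mul, hrw.self_of_nhds]
    push_cast
    rw [mul_div_cancel₀ _ two_ne_zero, Complex.exp_log (div_ne_zero h3 hx), mul_div_cancel₀ _ hx]
  have h5 : (r y - r x * Complex.exp (Complex.log (w y / w x) / 2))
      * (r y - -(r x * Complex.exp (Complex.log (w y / w x) / 2))) = 0 := by
    rw [← sub_eq_zero.2 (h1.trans h4.symm)]; ring
  exact sub_eq_zero.1 ((mul_eq_zero.1 h5).resolve_right h2)

end Smoothness

/-! ### Smoothness of the JWKB terms. -/

section Phase

/-- The pairs `(p, s)` such that `w(p, ·)` has no zero on `[-|s|, |s|]`. -/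
def wkbDomain (a b c : ℝ → ℂ) : Set ((ℝ × ℝ) × ℝ) :=
  {q | ∀ t ∈ Icc (-1 : ℝ) 1, eikonalW a b c q.1 (t * q.2) ≠ 0}

variable {a b c : ℝ → ℂ}

theorem contDiff_eikonalW (ha : ContDiff ℝ ∞ a) (hb : ContDiff ℝ ∞ b) (hc : ContDiff ℝ ∞ c)
    (ha0 : ∀ x, a x ≠ 0) : ContDiff ℝ ∞ fun q : (ℝ × ℝ) × ℝ => eikonalW a b c q.1 q.2 := by
  have hr : ContDiff ℝ ∞ fun x : ℝ => (x : ℂ) := Complex.ofRealCLM.contDiff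
  have h0 : ContDiff ℝ ∞ fun q : (ℝ × ℝ) × ℝ => q.1.1 := by fun_prop
  have h1 : ContDiff ℝ ∞ fun q : (ℝ × ℝ) × ℝ => q.1.1 + q.2 := by fun_prop
  have h2 : ContDiff ℝ ∞ fun q : (ℝ × ℝ) × ℝ => (q.1.2 : ℂ) := hr.comp (by fun_prop)
  unfold eikonalW
  refine (((contDiff_div ((ha.comp h0).mul (h2.pow 2)) (ha.comp h1) fun q => ha0 _).add
    (contDiff_div ((hb.comp h0).mul h2) (ha.comp h1) fun q => ha0 _)).add
    (contDiff_div ((hb.comp h1).pow 2) (contDiff_const.mul ((ha.comp h1).pow 2)) fun q => ?_)).add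
    (contDiff_div ((hc.comp h0).sub (hc.comp h1)) (ha.comp h1) fun q => ha0 _)
  exact mul_ne_zero (by norm_num) (pow_ne_zero _ (ha0 _))

theorem eikonalW_zero (ha0 : ∀ x, a x ≠ 0) (p : ℝ × ℝ) :
    eikonalW a b c p 0 = (p.2 + b p.1 / (2 * a p.1)) ^ 2 := by
  have := ha0 p.1
  simp only [eikonalW, add_zero]
  field_simp
  ring

theorem isOpen_wkbDomain (ha : ContDiff ℝ ∞ a) (hb : ContDiff ℝ ∞ b) (hc : ContDiff ℝ ∞ c)
    (ha0 : ∀ x, a x ≠ 0) : IsOpen (wkbDomain a b c) := by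
  rw [isOpen_iff_eventually]
  intro q hq
  refine isCompact_Icc.eventually_forall_of_forall_eventually fun t ht => ?_
  have hcont : Continuous fun z : ((ℝ × ℝ) × ℝ) × ℝ => eikonalW a b c z.1.1 (z.2 * z.1.2) :=
    (contDiff_eikonalW ha hb hc ha0).continuous.comp
      (g := fun q : (ℝ × ℝ) × ℝ => eikonalW a b c q.1 q.2)
      (f := fun z : ((ℝ × ℝ) × ℝ) × ℝ => (z.1.1, z.2 * z.1.2)) (by fun_prop)
  exact hcont.continuousAt.eventually_ne (hq t ht)

theorem mul_mem_wkbDomain {q : (ℝ × ℝ) × ℝ} (hq : q ∈ wkbDomain a b c) {t : ℝ}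
    (ht : t ∈ Icc (-1 : ℝ) 1) : (q.1, t * q.2) ∈ wkbDomain a b c := by
  intro r hr
  simp only [← mul_assoc]
  refine hq _ ?_
  have : |r * t| ≤ 1 := by
    rw [abs_mul]
    exact mul_le_one₀ (abs_le.2 hr) (abs_nonneg _) (abs_le.2 ht)
  exact abs_le.1 this

theorem mem_wkbDomain_of_abs_le {p : ℝ × ℝ} {d s : ℝ}
    (h : ∀ v : ℝ, |v| ≤ d → eikonalW a b c p v ≠ 0) (hs : |s| ≤ d) :
    (p, s) ∈ wkbDomain a b c := by
  intro t ht
  refine h _ ?_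
  rw [abs_mul]
  exact (mul_le_of_le_one_left (abs_nonneg _) (abs_le.2 ht)).trans hs

theorem eikonalW_ne_zero {q : (ℝ × ℝ) × ℝ} (hq : q ∈ wkbDomain a b c) :
    eikonalW a b c q.1 q.2 ≠ 0 := by
  simpa using hq 1 (by simp)

theorem eikonalW_ne_zero_of_mem_Icc {q : (ℝ × ℝ) × ℝ} (hq : q ∈ wkbDomain a b c) {v : ℝ}
    (hv : v ∈ Icc (-|q.2|) |q.2|) : eikonalW a b c q.1 v ≠ 0 := by
  rcases eq_or_ne q.2 0 with h0 | h0
  · have hv0 : v = 0 := by simpa [h0] using hv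
    have := hq 0 (by simp)
    simpa [hv0] using this
  · have h := hq (v / q.2) (abs_le.1 ?_)
    · rwa [div_mul_cancel₀ _ h0] at h
    · rw [abs_div]
      exact div_le_one_of_le₀ (abs_le.2 hv) (abs_nonneg _)

theorem contDiff_eikonalW_right (ha : ContDiff ℝ ∞ a) (hb : ContDiff ℝ ∞ b) (hc : ContDiff ℝ ∞ c)
    (ha0 : ∀ x, a x ≠ 0) (p : ℝ × ℝ) : ContDiff ℝ ∞ (eikonalW a b c p) :=
  (contDiff_eikonalW ha hb hc ha0).comp (f := fun s : ℝ => (p, s)) (by fun_prop)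

theorem eikonalRoot_sq (ha : ContDiff ℝ ∞ a) (hb : ContDiff ℝ ∞ b) (hc : ContDiff ℝ ∞ c)
    (ha0 : ∀ x, a x ≠ 0) {q : (ℝ × ℝ) × ℝ} (hq : q ∈ wkbDomain a b c) :
    eikonalRoot a b c q.1 q.2 ^ 2 = eikonalW a b c q.1 q.2 :=
  sqrtBranch_sq ((contDiff_eikonalW_right ha hb hc ha0 q.1).of_le (by norm_cast))
    (eikonalW_zero ha0 q.1).symm (fun _ hv => eikonalW_ne_zero_of_mem_Icc hq hv)
    ⟨neg_abs_le _, le_abs_self _⟩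

theorem eikonalRoot_ne_zero (ha : ContDiff ℝ ∞ a) (hb : ContDiff ℝ ∞ b) (hc : ContDiff ℝ ∞ c)
    (ha0 : ∀ x, a x ≠ 0) {q : (ℝ × ℝ) × ℝ} (hq : q ∈ wkbDomain a b c) :
    eikonalRoot a b c q.1 q.2 ≠ 0 := fun h => by
  have := eikonalRoot_sq ha hb hc ha0 hq
  rw [h] at this
  exact eikonalW_ne_zero hq (by simpa using this.symm)

/-- The integral formula for the branch is used only for joint continuity; being a continuous square
root of a smooth nonvanishing function then makes it smooth. -/
theorem contDiffOn_eikonalRoot (ha : ContDiff ℝ ∞ a) (hb : ContDiff ℝ ∞ b) (hc : ContDiff ℝ ∞ c)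
    (ha0 : ∀ x, a x ≠ 0) :
    ContDiffOn ℝ ∞ (fun q : (ℝ × ℝ) × ℝ => eikonalRoot a b c q.1 q.2) (wkbDomain a b c) := by
  have hDo := isOpen_wkbDomain ha hb hc ha0
  have hW := contDiff_eikonalW ha hb hc ha0
  have hcont : ContinuousOn (fun q : (ℝ × ℝ) × ℝ => eikonalRoot a b c q.1 q.2)
      (wkbDomain a b c) := by
    have h1 : ContinuousOn (fun q : (ℝ × ℝ) × ℝ => ∫ t in (0 : ℝ)..q.2,
        deriv (eikonalW a b c q.1) t / eikonalW a b c q.1 t) (wkbDomain a b c) := by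
      refine continuousOn_primitive
        (F := fun p t => deriv (eikonalW a b c p) t / eikonalW a b c p t) hDo
        (fun q hq t ht => mul_mem_wkbDomain hq ⟨by linarith [ht.1], ht.2⟩) ?_
      exact (contDiffOn_deriv_snd hDo hW.contDiffOn).continuousOn.div hW.continuous.continuousOn
        fun q hq => eikonalW_ne_zero hq
    have hz : Continuous fun q : (ℝ × ℝ) × ℝ => (q.1.2 : ℂ) + b q.1.1 / (2 * a q.1.1) := by
      refine (Complex.continuous_ofReal.comp (by fun_prop)).add ((hb.continuous.comp
        (by fun_prop)).div (continuous_const.mul (ha.continuous.comp (by fun_prop))) fun q => ?_)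
      exact mul_ne_zero two_ne_zero (ha0 _)
    unfold eikonalRoot sqrtBranch
    exact hz.continuousOn.mul (h1.div_const 2).cexp
  intro q hq
  have hnhds := hDo.mem_nhds hq
  refine (contDiffAt_of_sq (hcont.continuousAt hnhds) hW.contDiffAt ?_
    (eikonalW_ne_zero hq)).contDiffWithinAt
  filter_upwards [hnhds] with y hy using eikonalRoot_sq ha hb hc ha0 hy

theorem wkbDeriv_succ (p : ℝ × ℝ) (j : ℕ) (s : ℝ) : wkbDeriv a b c p (j + 1) s =
    -a (p.1 + s) * (deriv (wkbDeriv a b c p j) s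
        + ∑ i : Fin j, wkbDeriv a b c p (i + 1) s * wkbDeriv a b c p (j - i) s)
      / (2 * a (p.1 + s) * wkbDeriv a b c p 0 s + Complex.I * b (p.1 + s)) := by
  rw [wkbDeriv.eq_2]

theorem contDiffOn_wkbDeriv (ha : ContDiff ℝ ∞ a) (hb : ContDiff ℝ ∞ b) (hc : ContDiff ℝ ∞ c)
    (ha0 : ∀ x, a x ≠ 0) (j : ℕ) :
    ContDiffOn ℝ ∞ (fun q : (ℝ × ℝ) × ℝ => wkbDeriv a b c q.1 j q.2) (wkbDomain a b c) := by
  have hDo := isOpen_wkbDomain ha hb hc ha0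
  have hs : ContDiff ℝ ∞ fun q : (ℝ × ℝ) × ℝ => q.1.1 + q.2 := by fun_prop
  have has := (ha.comp hs).contDiffOn (s := wkbDomain a b c)
  have hbs := (hb.comp hs).contDiffOn (s := wkbDomain a b c)
  have hroot := contDiffOn_eikonalRoot ha hb hc ha0
  induction j using Nat.strong_induction_on with
  | _ j ih =>
    rcases j with _ | j
    · simp only [wkbDeriv]
      exact contDiffOn_const.mul ((contDiffOn_div hbs (contDiffOn_const.mul has)
        fun q _ => mul_ne_zero two_ne_zero (ha0 _)).neg.add hroot)
    · have h0 := ih 0 (Nat.succ_pos j)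
      refine ContDiffOn.congr ?_ fun q _ => wkbDeriv_succ q.1 j q.2
      have h1 : ContDiffOn ℝ ∞ (fun q : (ℝ × ℝ) × ℝ => deriv (wkbDeriv a b c q.1 j) q.2)
          (wkbDomain a b c) :=
        contDiffOn_deriv_snd (G := fun p => wkbDeriv a b c p j) hDo (ih j j.lt_succ_self)
      have h2 : ContDiffOn ℝ ∞ (fun q : (ℝ × ℝ) × ℝ => ∑ i : Fin j,
          wkbDeriv a b c q.1 (i + 1) q.2 * wkbDeriv a b c q.1 (j - i) q.2) (wkbDomain a b c) :=
        ContDiffOn.sum fun i _ => (ih (i + 1) (by omega)).mul (ih (j - i) (by omega))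
      refine contDiffOn_div (has.neg.mul (h1.add h2)) ((contDiffOn_const.mul has).mul
        h0 |>.add (contDiffOn_const.mul hbs)) fun q hq => ?_
      -- The transport denominator equals `2 i a √w`, as the `b` terms cancel, so it vanishes
      -- nowhere on `wkbDomain`.
      have h : 2 * a (q.1.1 + q.2) * (Complex.I * (-(b (q.1.1 + q.2) / (2 * a (q.1.1 + q.2)))
          + eikonalRoot a b c q.1 q.2)) + Complex.I * b (q.1.1 + q.2)
          = 2 * a (q.1.1 + q.2) * Complex.I * eikonalRoot a b c q.1 q.2 := by
        have := ha0 (q.1.1 + q.2)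
        field_simp
        ring
      simp only [wkbDeriv]
      rw [h]
      exact mul_ne_zero (mul_ne_zero (mul_ne_zero two_ne_zero (ha0 _)) Complex.I_ne_zero)
        (eikonalRoot_ne_zero ha hb hc ha0 hq)

theorem continuousOn_wkbTerm (ha : ContDiff ℝ ∞ a) (hb : ContDiff ℝ ∞ b) (hc : ContDiff ℝ ∞ c)
    (ha0 : ∀ x, a x ≠ 0) (j : ℕ) :
    ContinuousOn (fun q : (ℝ × ℝ) × ℝ => wkbTerm a b c q.1 j q.2) (wkbDomain a b c) :=
  continuousOn_primitive (F := fun p t => wkbDeriv a b c p j t) (isOpen_wkbDomain ha hb hc ha0)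
    (fun _ hq _ ht => mul_mem_wkbDomain hq ⟨by linarith [ht.1], ht.2⟩)
    (contDiffOn_wkbDeriv ha hb hc ha0 j).continuousOn

theorem continuousOn_wkbPhase (ha : ContDiff ℝ ∞ a) (hb : ContDiff ℝ ∞ b) (hc : ContDiff ℝ ∞ c)
    (ha0 : ∀ x, a x ≠ 0) (N : ℕ) (h : ℝ) :
    ContinuousOn (fun q : (ℝ × ℝ) × ℝ => wkbPhase a b c N h q.1 q.2) (wkbDomain a b c) :=
  continuousOn_finsetSum _ fun j _ =>
    continuousOn_const.mul (continuousOn_wkbTerm ha hb hc ha0 j)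

end Phase

/-! ### The bracket condition and the quadratic coefficient `k`. -/

section Region

variable {a b c : ℝ → ℂ}

theorem hasDerivAt_symbol_fst (ha : ContDiff ℝ ∞ a) (hb : ContDiff ℝ ∞ b) (hc : ContDiff ℝ ∞ c)
    (u ξ : ℝ) : HasDerivAt (fun v : ℝ => symbol a b c v ξ)
      (deriv a u * (ξ : ℂ) ^ 2 + deriv b u * ξ + deriv c u) u := by
  have hd : ∀ {f : ℝ → ℂ}, ContDiff ℝ ∞ f → HasDerivAt f (deriv f u) u := fun hf =>
    (hf.differentiable (by norm_num) u).hasDerivAt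
  exact (((hd ha).mul_const _).add ((hd hb).mul_const _)).add (hd hc)

theorem hasDerivAt_symbol_snd (a b c : ℝ → ℂ) (u ξ : ℝ) :
    HasDerivAt (fun η : ℝ => symbol a b c u η) (2 * a u * ξ + b u) ξ := by
  have h0 : HasDerivAt (fun η : ℝ => (η : ℂ)) 1 ξ := Complex.ofRealCLM.hasDerivAt
  have h := (((h0.pow 2).const_mul (a u)).add (h0.const_mul (b u))).add_const (c u)
  refine h.congr_deriv ?_
  push_cast
  ring

theorem hasDerivAt_re {f : ℝ → ℂ} {f' : ℂ} {x : ℝ} (hf : HasDerivAt f f' x) :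
    HasDerivAt (fun y => (f y).re) f'.re x :=
  Complex.reCLM.hasFDerivAt.comp_hasDerivAt x hf

theorem hasDerivAt_im {f : ℝ → ℂ} {f' : ℂ} {x : ℝ} (hf : HasDerivAt f f' x) :
    HasDerivAt (fun y => (f y).im) f'.im x :=
  Complex.imCLM.hasFDerivAt.comp_hasDerivAt x hf

theorem symbolDu_eq (ha : ContDiff ℝ ∞ a) (hb : ContDiff ℝ ∞ b) (hc : ContDiff ℝ ∞ c) (u ξ : ℝ) :
    symbolDu a b c u ξ = deriv a u * (ξ : ℂ) ^ 2 + deriv b u * ξ + deriv c u :=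
  (hasDerivAt_symbol_fst ha hb hc u ξ).deriv

theorem symbolDxi_eq (a b c : ℝ → ℂ) (u ξ : ℝ) :
    symbolDxi a b c u ξ = 2 * a u * ξ + b u :=
  (hasDerivAt_symbol_snd a b c u ξ).deriv

theorem bracket_eq (ha : ContDiff ℝ ∞ a) (hb : ContDiff ℝ ∞ b) (hc : ContDiff ℝ ∞ c) (u ξ : ℝ) :
    bracket a b c u ξ = (symbolDu a b c u ξ).re * (symbolDxi a b c u ξ).im
      - (symbolDxi a b c u ξ).re * (symbolDu a b c u ξ).im := by
  have h1 := hasDerivAt_symbol_fst ha hb hc u ξ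
  have h2 := hasDerivAt_symbol_snd a b c u ξ
  rw [bracket, symbolDu_eq ha hb hc, symbolDxi_eq, (hasDerivAt_re h1).deriv,
    (hasDerivAt_im h1).deriv, (hasDerivAt_re h2).deriv, (hasDerivAt_im h2).deriv]

theorem continuous_symbolDu (ha : ContDiff ℝ ∞ a) (hb : ContDiff ℝ ∞ b) (hc : ContDiff ℝ ∞ c) :
    Continuous fun p : ℝ × ℝ => symbolDu a b c p.1 p.2 := by
  simp only [symbolDu_eq ha hb hc]
  have h1 := ha.continuous_deriv (by simp)
  have h2 := hb.continuous_deriv (by simp)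
  have h3 := hc.continuous_deriv (by simp)
  fun_prop

theorem continuous_symbolDxi (ha : ContDiff ℝ ∞ a) (hb : ContDiff ℝ ∞ b) :
    Continuous fun p : ℝ × ℝ => symbolDxi a b c p.1 p.2 := by
  simp only [symbolDxi_eq]
  have h1 := ha.continuous
  have h2 := hb.continuous
  fun_prop

theorem isOpen_phaseRegion (ha : ContDiff ℝ ∞ a) (hb : ContDiff ℝ ∞ b) (hc : ContDiff ℝ ∞ c) :
    IsOpen (phaseRegion a b c) := by
  have h1 := continuous_symbolDu ha hb hc
  have h2 := continuous_symbolDxi (c := c) ha hb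
  simp only [phaseRegion, bracket_eq ha hb hc]
  exact isOpen_lt continuous_const (by fun_prop)

theorem symbolDxi_ne_zero (ha : ContDiff ℝ ∞ a) (hb : ContDiff ℝ ∞ b) (hc : ContDiff ℝ ∞ c)
    {p : ℝ × ℝ} (hp : p ∈ phaseRegion a b c) : symbolDxi a b c p.1 p.2 ≠ 0 := fun h => by
  have hp' : 0 < bracket a b c p.1 p.2 := hp
  simp [bracket_eq ha hb hc, h] at hp'

/-- The real part of `k` is minus the Poisson bracket divided by `|∂σ/∂ξ|²`. -/
theorem gaussianCoeff_re_neg (ha : ContDiff ℝ ∞ a) (hb : ContDiff ℝ ∞ b) (hc : ContDiff ℝ ∞ c)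
    {p : ℝ × ℝ} (hp : p ∈ phaseRegion a b c) : (gaussianCoeff a b c p).re < 0 := by
  have hp' : 0 < bracket a b c p.1 p.2 := hp
  have h0 : 0 < Complex.normSq (symbolDxi a b c p.1 p.2) :=
    Complex.normSq_pos.2 (symbolDxi_ne_zero ha hb hc hp)
  have h : (gaussianCoeff a b c p).re
      = -bracket a b c p.1 p.2 / Complex.normSq (symbolDxi a b c p.1 p.2) := by
    rw [bracket_eq ha hb hc]
    simp [gaussianCoeff, Complex.inv_re, Complex.inv_im]
    ring
  rw [h]
  exact div_neg_of_neg_of_pos (neg_neg_of_pos hp') h0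

theorem continuousOn_gaussianCoeff (ha : ContDiff ℝ ∞ a) (hb : ContDiff ℝ ∞ b)
    (hc : ContDiff ℝ ∞ c) : ContinuousOn (gaussianCoeff a b c) (phaseRegion a b c) :=
  (continuous_const.mul (continuous_symbolDu ha hb hc)).continuousOn.mul
    ((continuous_symbolDxi ha hb).continuousOn.inv₀ fun _ hp => symbolDxi_ne_zero ha hb hc hp)

theorem mem_wkbDomain_zero (ha : ContDiff ℝ ∞ a) (hb : ContDiff ℝ ∞ b) (hc : ContDiff ℝ ∞ c)
    (ha0 : ∀ x, a x ≠ 0) {p : ℝ × ℝ} (hp : p ∈ phaseRegion a b c) :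
    (p, (0 : ℝ)) ∈ wkbDomain a b c := by
  intro t _
  have h := symbolDxi_ne_zero ha hb hc hp
  rw [symbolDxi_eq] at h
  simp only [mul_zero]
  rw [eikonalW_zero ha0]
  refine pow_ne_zero 2 fun h0 => h ?_
  have := ha0 p.1
  field_simp at h0
  linear_combination h0

theorem wkbDeriv_zero_zero (p : ℝ × ℝ) : wkbDeriv a b c p 0 0 = Complex.I * p.2 := by
  simp [wkbDeriv, eikonalRoot, sqrtBranch_zero]

/-- With `ψ₋₁' = i η`, the eikonal equation reads `σ(u + s, η(s)) = σ(u, ξ)`, the symbol being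
extended to complex `η`. Its derivative at 0 is `∂σ/∂u + (∂σ/∂ξ) η'(0) = 0`, and `i η'(0)` is then
`k`. -/
theorem deriv_wkbDeriv_zero (ha : ContDiff ℝ ∞ a) (hb : ContDiff ℝ ∞ b) (hc : ContDiff ℝ ∞ c)
    (ha0 : ∀ x, a x ≠ 0) {p : ℝ × ℝ} (hp : p ∈ phaseRegion a b c) :
    deriv (wkbDeriv a b c p 0) 0 = gaussianCoeff a b c p := by
  have hD := mem_wkbDomain_zero ha hb hc ha0 hp
  have hDo := isOpen_wkbDomain ha hb hc ha0
  have hF : HasDerivAt (wkbDeriv a b c p 0) (deriv (wkbDeriv a b c p 0) 0) 0 :=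
    (hasDerivAt_of_contDiffOn (G := fun p s => wkbDeriv a b c p 0 s) hDo
      (contDiffOn_wkbDeriv ha hb hc ha0 0) hD).differentiableAt.hasDerivAt
  have hd : ∀ {f : ℝ → ℂ}, ContDiff ℝ ∞ f → HasDerivAt (fun s => f (p.1 + s)) (deriv f p.1) 0 :=
    fun {f} hf => by
      have h1 : HasDerivAt f (deriv f p.1) (p.1 + 0) := by
        rw [add_zero]; exact (hf.differentiable (by norm_num) p.1).hasDerivAt
      exact h1.comp_const_add p.1 0
  set k := deriv (wkbDeriv a b c p 0) 0
  have hE := (((hd ha).neg.mul (hF.pow 2)).sub (((hd hb).const_mul Complex.I).mul hF)).add (hd hc)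
  -- The eikonal equation, valid near `s = 0` because the root squares to `w` there.
  have hconst : ∀ᶠ s in 𝓝 (0 : ℝ), -a (p.1 + s) * wkbDeriv a b c p 0 s ^ 2
      - Complex.I * b (p.1 + s) * wkbDeriv a b c p 0 s + c (p.1 + s) = symbol a b c p.1 p.2 := by
    have hev : ∀ᶠ s in 𝓝 (0 : ℝ), (p, s) ∈ wkbDomain a b c :=
      (by fun_prop : Continuous fun s : ℝ => (p, s)).continuousAt.eventually (hDo.mem_nhds hD)
    filter_upwards [hev] with s hs
    have hr := eikonalRoot_sq ha hb hc ha0 hs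
    have hne := ha0 (p.1 + s)
    simp only [eikonalW] at hr
    simp only [wkbDeriv, symbol]
    have hI : Complex.I ^ 2 = -1 := Complex.I_sq
    field_simp at hr ⊢
    linear_combination hr + (b (p.1 + s) ^ 2
      - 4 * eikonalRoot a b c p s ^ 2 * a (p.1 + s) ^ 2) * hI
  have h0 := hE.congr_of_eventuallyEq (hconst.mono fun s hs => hs.symm)
  have h1 := h0.unique (hasDerivAt_const (0 : ℝ) (symbol a b c p.1 p.2))
  have hx := symbolDxi_ne_zero ha hb hc hp
  have hI : Complex.I ^ 2 = -1 := Complex.I_sq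
  simp only [Pi.pow_apply, Pi.neg_apply, wkbDeriv_zero_zero, add_zero, Nat.add_one_sub_one,
    pow_one, Nat.cast_ofNat] at h1
  rw [gaussianCoeff, ← div_eq_mul_inv, eq_div_iff hx, symbolDu_eq ha hb hc, symbolDxi_eq]
  linear_combination Complex.I * h1 + (2 * k * a p.1 * p.2 + k * b p.1
    + Complex.I * p.2 * deriv b p.1 + Complex.I * p.2 ^ 2 * deriv a p.1) * hI

end Region

/-! ### Uniform Taylor bounds on compact sets star-shaped in `s`. -/

section Taylor

variable {a b c : ℝ → ℂ} {S : Set ((ℝ × ℝ) × ℝ)}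

theorem mem_of_mem_uIcc_zero (hS : ∀ q ∈ S, ∀ t ∈ Icc (0 : ℝ) 1, (q.1, t * q.2) ∈ S)
    {q : (ℝ × ℝ) × ℝ} (hq : q ∈ S) {t : ℝ} (ht : t ∈ uIcc 0 q.2) : (q.1, t) ∈ S := by
  rw [← segment_eq_uIcc, segment_eq_image] at ht
  obtain ⟨θ, hθ, rfl⟩ := ht
  simpa using hS q hq θ hθ

theorem exists_norm_wkbTerm_le (ha : ContDiff ℝ ∞ a) (hb : ContDiff ℝ ∞ b) (hc : ContDiff ℝ ∞ c)
    (ha0 : ∀ x, a x ≠ 0) (hSc : IsCompact S) (hSD : S ⊆ wkbDomain a b c)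
    (hS : ∀ q ∈ S, ∀ t ∈ Icc (0 : ℝ) 1, (q.1, t * q.2) ∈ S) (j : ℕ) :
    ∃ C : ℝ, 0 ≤ C ∧ ∀ q ∈ S, ‖wkbTerm a b c q.1 j q.2‖ ≤ C * |q.2| := by
  obtain ⟨C, hC⟩ := hSc.exists_bound_of_continuousOn
    ((contDiffOn_wkbDeriv ha hb hc ha0 j).continuousOn.mono hSD)
  refine ⟨max C 0, le_max_right _ _, fun q hq => ?_⟩
  have h := intervalIntegral.norm_integral_le_of_norm_le_const (a := 0) (b := q.2) (C := max C 0)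
    (f := wkbDeriv a b c q.1 j) fun t ht => (hC (q.1, t)
      (mem_of_mem_uIcc_zero hS hq (uIoc_subset_uIcc ht))).trans (le_max_left _ _)
  rw [sub_zero] at h
  exact h

/-- The constant bounds `ψ₋₁'''` on `S`. Two mean value estimates and one integration along the
segment from 0 to `s`, which stays in `S`, give the cubic remainder uniformly in `p`. -/
theorem exists_norm_eikonal_sub_le (ha : ContDiff ℝ ∞ a) (hb : ContDiff ℝ ∞ b)
    (hc : ContDiff ℝ ∞ c) (ha0 : ∀ x, a x ≠ 0) (hSc : IsCompact S) (hSD : S ⊆ wkbDomain a b c)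
    (hS : ∀ q ∈ S, ∀ t ∈ Icc (0 : ℝ) 1, (q.1, t * q.2) ∈ S)
    (hSΩ : ∀ q ∈ S, q.1 ∈ phaseRegion a b c) :
    ∃ C : ℝ, 0 ≤ C ∧ ∀ q ∈ S, ‖wkbTerm a b c q.1 0 q.2
      - (Complex.I * q.1.2 * q.2 + gaussianCoeff a b c q.1 * (q.2 : ℂ) ^ 2 / 2)‖
        ≤ C * |q.2| ^ 3 := by
  have hDo := isOpen_wkbDomain ha hb hc ha0
  have h0 : ContDiffOn ℝ ∞ (fun q : (ℝ × ℝ) × ℝ => wkbDeriv a b c q.1 0 q.2) (wkbDomain a b c) :=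
    contDiffOn_wkbDeriv ha hb hc ha0 0
  have h1 : ContDiffOn ℝ ∞ (fun q : (ℝ × ℝ) × ℝ => deriv (wkbDeriv a b c q.1 0) q.2)
      (wkbDomain a b c) := contDiffOn_deriv_snd (G := fun p => wkbDeriv a b c p 0) hDo h0
  have h2 : ContDiffOn ℝ ∞ (fun q : (ℝ × ℝ) × ℝ => deriv (deriv (wkbDeriv a b c q.1 0)) q.2)
      (wkbDomain a b c) := contDiffOn_deriv_snd (G := fun p => deriv (wkbDeriv a b c p 0)) hDo h1
  obtain ⟨C, hC⟩ := hSc.exists_bound_of_continuousOn (h2.continuousOn.mono hSD)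
  refine ⟨max C 0, le_max_right _ _, fun q hq => ?_⟩
  set p := q.1
  set s := q.2
  set k := gaussianCoeff a b c p
  set F := wkbDeriv a b c p 0 with hF
  have hk : deriv F 0 = k := deriv_wkbDeriv_zero ha hb hc ha0 (hSΩ q hq)
  have hF0 : F 0 = Complex.I * p.2 := wkbDeriv_zero_zero p
  have hmem : ∀ t ∈ uIcc 0 s, (p, t) ∈ S := fun t ht => mem_of_mem_uIcc_zero hS hq ht
  have habs : ∀ t ∈ uIcc 0 s, |t| ≤ |s| := fun t ht => by
    simpa using abs_sub_left_of_mem_uIcc ht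
  have hd1 : ∀ t ∈ uIcc 0 s, HasDerivAt F (deriv F t) t := fun t ht =>
    (hasDerivAt_of_contDiffOn (G := fun p => wkbDeriv a b c p 0) hDo h0
      (hSD (hmem t ht))).differentiableAt.hasDerivAt
  have hd2 : ∀ t ∈ uIcc 0 s, HasDerivAt (deriv F) (deriv (deriv F) t) t := fun t ht =>
    (hasDerivAt_of_contDiffOn (G := fun p => deriv (wkbDeriv a b c p 0)) hDo h1
      (hSD (hmem t ht))).differentiableAt.hasDerivAt
  have hM1 : ∀ t ∈ uIcc 0 s, ‖deriv F t - k‖ ≤ max C 0 * |s| := fun t ht => by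
    have h := (convex_uIcc 0 s).norm_image_sub_le_of_norm_hasDerivWithin_le (C := max C 0)
      (fun x hx => (hd2 x hx).hasDerivWithinAt)
      (fun x hx => (hC _ (hmem x hx)).trans (le_max_left _ _)) left_mem_uIcc ht
    rw [hk, sub_zero, Real.norm_eq_abs] at h
    exact h.trans (mul_le_mul_of_nonneg_left (habs t ht) (le_max_right _ _))
  have hof : ∀ t : ℝ, HasDerivAt (fun t : ℝ => (t : ℂ)) 1 t := fun t =>
    Complex.ofRealCLM.hasDerivAt
  have hM2 : ∀ t ∈ uIcc 0 s, ‖F t - Complex.I * p.2 - k * t‖ ≤ max C 0 * |s| ^ 2 := fun t ht => by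
    have h := (convex_uIcc 0 s).norm_image_sub_le_of_norm_hasDerivWithin_le
      (f := fun t : ℝ => F t - k * t) (C := max C 0 * |s|)
      (fun x hx => ((hd1 x hx).sub ((hof x).const_mul k)).hasDerivWithinAt)
      (fun x hx => by rw [mul_one]; exact hM1 x hx) left_mem_uIcc ht
    simp only [hF0, Complex.ofReal_zero, mul_zero, sub_zero, Real.norm_eq_abs] at h
    rw [sub_right_comm, pow_two, ← mul_assoc]
    exact h.trans (mul_le_mul_of_nonneg_left (habs t ht) (by positivity))
  have hint : IntervalIntegrable F volume 0 s :=
    ContinuousOn.intervalIntegrable fun t ht => (hd1 t ht).continuousAt.continuousWithinAt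
  have heq : wkbTerm a b c p 0 s - (Complex.I * p.2 * s + k * (s : ℂ) ^ 2 / 2)
      = ∫ t in (0 : ℝ)..s, (F t - Complex.I * p.2 - k * t) := by
    rw [intervalIntegral.integral_sub (hint.sub intervalIntegrable_const)
        (Continuous.intervalIntegrable (by fun_prop) _ _),
      intervalIntegral.integral_sub hint intervalIntegrable_const,
      intervalIntegral.integral_const, intervalIntegral.integral_const_mul,
      intervalIntegral.integral_ofReal, integral_id, wkbTerm]
    simp
    ring
  rw [heq]
  have h := intervalIntegral.norm_integral_le_of_norm_le_const (a := 0) (b := s)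
    fun t ht => hM2 t (uIoc_subset_uIcc ht)
  rw [sub_zero] at h
  exact h.trans_eq (by ring)

theorem exists_eikonal_re_le (ha : ContDiff ℝ ∞ a) (hb : ContDiff ℝ ∞ b)
    (hc : ContDiff ℝ ∞ c) (ha0 : ∀ x, a x ≠ 0) (hSc : IsCompact S) (hSD : S ⊆ wkbDomain a b c)
    (hS : ∀ q ∈ S, ∀ t ∈ Icc (0 : ℝ) 1, (q.1, t * q.2) ∈ S)
    (hSΩ : ∀ q ∈ S, q.1 ∈ phaseRegion a b c) :
    ∃ κ r : ℝ, 0 < κ ∧ 0 < r ∧ ∀ q ∈ S, (gaussianCoeff a b c q.1).re ≤ -4 * κ ∧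
      (|q.2| ≤ r → (wkbTerm a b c q.1 0 q.2).re ≤ -κ * q.2 ^ 2) := by
  obtain ⟨C, hC0, hC⟩ := exists_norm_eikonal_sub_le ha hb hc ha0 hSc hSD hS hSΩ
  obtain ⟨κ, hκ, hκS⟩ := hSc.exists_forall_le' (a := (0 : ℝ))
    (f := fun q : (ℝ × ℝ) × ℝ => -(gaussianCoeff a b c q.1).re)
    ((Complex.continuous_re.comp_continuousOn ((continuousOn_gaussianCoeff ha hb hc).comp
      continuous_fst.continuousOn hSΩ)).neg)
    (fun q hq => neg_pos.2 (gaussianCoeff_re_neg ha hb hc (hSΩ q hq)))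
  -- The quadratic term is at most `-κ s² / 2`; for `|s| ≤ r` the cubic error uses up at most `κ s²
  -- / 4`. The `+ 1` keeps the radius defined when `C = 0`.
  refine ⟨κ / 4, κ / 4 / (C + 1), by positivity, by positivity, fun q hq => ⟨?_, fun hqr => ?_⟩⟩
  · linarith [hκS q hq]
  have h1 := (Complex.re_le_norm _).trans (hC q hq)
  have h2 : (Complex.I * q.1.2 * q.2 + gaussianCoeff a b c q.1 * (q.2 : ℂ) ^ 2 / 2).re
      = (gaussianCoeff a b c q.1).re * q.2 ^ 2 / 2 := by
    rw [← Complex.ofReal_pow]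
    simp [-Complex.ofReal_pow]
  rw [Complex.sub_re, h2] at h1
  have h3 : C * |q.2| ^ 3 ≤ κ / 4 * q.2 ^ 2 := by
    have h4 : C * |q.2| ≤ κ / 4 := by
      rw [le_div_iff₀ (by positivity)] at hqr
      nlinarith [abs_nonneg q.2]
    calc C * |q.2| ^ 3 = C * |q.2| * |q.2| ^ 2 := by ring
      _ ≤ κ / 4 * |q.2| ^ 2 := by gcongr
      _ = _ := by rw [sq_abs]
  have h5 := mul_le_mul_of_nonneg_right (hκS q hq) (sq_nonneg q.2)
  nlinarith

/-- Near `s = 0` the Taylor bound applies. For `|s| ≥ r` the strictly negative continuous function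
`Re ψ₋₁` is at most some `-m < 0` by compactness, which beats `-κ s²` for small `κ` because `s` is
bounded on `S`. -/
theorem exists_eikonal_re_le_of_neg (ha : ContDiff ℝ ∞ a) (hb : ContDiff ℝ ∞ b)
    (hc : ContDiff ℝ ∞ c) (ha0 : ∀ x, a x ≠ 0) (hSc : IsCompact S) (hSD : S ⊆ wkbDomain a b c)
    (hS : ∀ q ∈ S, ∀ t ∈ Icc (0 : ℝ) 1, (q.1, t * q.2) ∈ S)
    (hSΩ : ∀ q ∈ S, q.1 ∈ phaseRegion a b c)
    (hneg : ∀ q ∈ S, q.2 ≠ 0 → (wkbTerm a b c q.1 0 q.2).re < 0) :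
    ∃ κ : ℝ, 0 < κ ∧ ∀ q ∈ S, (gaussianCoeff a b c q.1).re / 2 ≤ -κ ∧
      (wkbTerm a b c q.1 0 q.2).re ≤ -κ * q.2 ^ 2 := by
  obtain ⟨κ, r, hκ, hr, h⟩ := exists_eikonal_re_le ha hb hc ha0 hSc hSD hS hSΩ
  have hT : IsCompact (S ∩ {q | r ≤ |q.2|}) :=
    hSc.inter_right (isClosed_le continuous_const (by fun_prop))
  obtain ⟨m, hm, hmS⟩ := hT.exists_forall_le' (a := (0 : ℝ))
    (f := fun q : (ℝ × ℝ) × ℝ => -(wkbTerm a b c q.1 0 q.2).re)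
    ((Complex.continuous_re.comp_continuousOn ((continuousOn_wkbTerm ha hb hc ha0 0).mono
      (inter_subset_left.trans hSD))).neg)
    (fun q hq => neg_pos.2 (hneg q hq.1 (abs_pos.1 (hr.trans_le hq.2))))
  obtain ⟨R, hR⟩ := hSc.exists_bound_of_continuousOn (f := fun q : (ℝ × ℝ) × ℝ => q.2)
    continuous_snd.continuousOn
  have hR' : 0 < R ^ 2 + 1 := by positivity
  refine ⟨min κ (m / (R ^ 2 + 1)), lt_min hκ (by positivity), fun q hq => ⟨?_, ?_⟩⟩
  · have := min_le_left κ (m / (R ^ 2 + 1))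
    linarith [(h q hq).1]
  · have hs := sq_nonneg q.2
    rcases le_total |q.2| r with h1 | h1
    · have := mul_le_mul_of_nonneg_right (min_le_left κ (m / (R ^ 2 + 1))) hs
      linarith [(h q hq).2 h1]
    · have h2 := mul_le_mul_of_nonneg_right (min_le_right κ (m / (R ^ 2 + 1))) hs
      have h3 := hmS q ⟨hq, h1⟩
      have h4 : q.2 ^ 2 ≤ R ^ 2 + 1 := by
        have := pow_le_pow_left₀ (norm_nonneg _) (hR q hq) 2
        rw [Real.norm_eq_abs, sq_abs] at this
        linarith
      have h5 : m / (R ^ 2 + 1) * q.2 ^ 2 ≤ m := by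
        calc m / (R ^ 2 + 1) * q.2 ^ 2 ≤ m / (R ^ 2 + 1) * (R ^ 2 + 1) := by gcongr
          _ = m := div_mul_cancel₀ _ hR'.ne'
      linarith

end Taylor

/-! ### Existence of admissible cutoffs. -/

section Cutoff

variable {a b c : ℝ → ℂ}

theorem exists_local_radius (ha : ContDiff ℝ ∞ a) (hb : ContDiff ℝ ∞ b) (hc : ContDiff ℝ ∞ c)
    (ha0 : ∀ x, a x ≠ 0) {p₀ : ℝ × ℝ} (hp₀ : p₀ ∈ phaseRegion a b c) :
    ∃ r : ℝ, 0 < r ∧ ∀ᶠ p in 𝓝 p₀, ∀ s : ℝ, |s| ≤ r →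
      eikonalW a b c p s ≠ 0 ∧ (s ≠ 0 → (wkbTerm a b c p 0 s).re < 0) := by
  have hO : IsOpen (wkbDomain a b c ∩ Prod.fst ⁻¹' phaseRegion a b c) :=
    (isOpen_wkbDomain ha hb hc ha0).inter ((isOpen_phaseRegion ha hb hc).preimage continuous_fst)
  obtain ⟨ε, hε, hsub⟩ : ∃ ε : ℝ, 0 < ε ∧ Metric.closedBall (p₀, (0 : ℝ)) ε
      ⊆ wkbDomain a b c ∩ Prod.fst ⁻¹' phaseRegion a b c :=
    Metric.nhds_basis_closedBall.mem_iff.1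
      (hO.mem_nhds ⟨mem_wkbDomain_zero ha hb hc ha0 hp₀, hp₀⟩)
  set S := Metric.closedBall (p₀, (0 : ℝ)) ε with hSdef
  have hmemS : ∀ q : (ℝ × ℝ) × ℝ, q ∈ S ↔ dist q.1 p₀ ≤ ε ∧ |q.2| ≤ ε := fun q => by
    rw [hSdef, Metric.mem_closedBall, Prod.dist_eq, max_le_iff, dist_zero_right, Real.norm_eq_abs]
  have hS : ∀ q ∈ S, ∀ t ∈ Icc (0 : ℝ) 1, (q.1, t * q.2) ∈ S := fun q hq t ht => by
    rw [hmemS] at hq ⊢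
    refine ⟨hq.1, ?_⟩
    rw [abs_mul, abs_of_nonneg ht.1]
    exact (mul_le_of_le_one_left (abs_nonneg _) ht.2).trans hq.2
  obtain ⟨κ, r, hκ, hr, h⟩ := exists_eikonal_re_le ha hb hc ha0 (isCompact_closedBall _ ε)
    (fun q hq => (hsub hq).1) hS (fun q hq => (hsub hq).2)
  refine ⟨min r ε, lt_min hr hε, ?_⟩
  filter_upwards [Metric.closedBall_mem_nhds p₀ hε] with p hp s hs
  have hmem : (p, s) ∈ S := (hmemS _).2 ⟨hp, hs.trans (min_le_right _ _)⟩
  have hw : eikonalW a b c p s ≠ 0 := eikonalW_ne_zero (q := (p, s)) (hsub hmem).1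
  have hre : (wkbTerm a b c p 0 s).re ≤ -κ * s ^ 2 :=
    (h (p, s) hmem).2 (hs.trans (min_le_left _ _))
  refine ⟨hw, fun hs0 => hre.trans_lt ?_⟩
  have : 0 < κ * s ^ 2 := by positivity
  linarith

theorem exists_isCutoff (ha : ContDiff ℝ ∞ a) (hb : ContDiff ℝ ∞ b) (hc : ContDiff ℝ ∞ c)
    (ha0 : ∀ x, a x ≠ 0) : ∃ δ χ, IsCutoff a b c δ χ := by
  classical
  let t : phaseRegion a b c → Set ℝ := fun p => {r | 0 < r ∧ ∀ s : ℝ, |s| ≤ r →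
      eikonalW a b c p s ≠ 0 ∧ (s ≠ 0 → (wkbTerm a b c p 0 s).re < 0)}
  have ht : ∀ p, Convex ℝ (t p) := fun p => by
    refine OrdConnected.convex ⟨fun x hx y hy z hz => ⟨hx.1.trans_le hz.1, fun s hs => ?_⟩⟩
    exact hy.2 s (hs.trans hz.2)
  -- The admissible radii at `p` form an interval, and a single radius works near each point, so a
  -- partition of unity glues the local constants continuously.
  obtain ⟨g, hg⟩ := exists_continuous_forall_mem_convex_of_local_const ht fun p => by
    obtain ⟨r, hr, h⟩ := exists_local_radius ha hb hc ha0 p.2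
    refine ⟨r, ?_⟩
    filter_upwards [continuous_subtype_val.continuousAt.eventually h] with y hy using ⟨hr, hy⟩
  let δ : ℝ × ℝ → ℝ := fun p => if h : p ∈ phaseRegion a b c then g ⟨p, h⟩ else 1
  have hδ : ∀ p (h : p ∈ phaseRegion a b c), δ p = g ⟨p, h⟩ := fun p h => dif_pos h
  have hpos : ∀ p ∈ phaseRegion a b c, 0 < δ p := fun p h => by rw [hδ p h]; exact (hg _).1
  have hδc : ContinuousOn δ (phaseRegion a b c) := by
    rw [continuousOn_iff_continuous_domRestrict]
    refine g.continuous.congr fun p => ?_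
    exact (hδ p p.2).symm
  -- At `|s| = δ/2` the argument is `(1 - 1/4)(4/3) = 1`, where the transition has reached 1; for
  -- `|s| ≥ δ` it is nonpositive.
  refine ⟨δ, fun p s => Real.smoothTransition ((1 - (s / δ p) ^ 2) * (4 / 3)),
    { radius_pos := hpos
      radius_continuousOn := hδc
      w_ne_zero := fun p hp s hs => ((hg ⟨p, hp⟩).2 s (by rwa [← hδ p hp])).1
      phase_neg := fun p hp s hs0 hs => ((hg ⟨p, hp⟩).2 s (by rwa [← hδ p hp])).2 hs0
      smooth := fun p _ => Real.smoothTransition.contDiff.comp (by fun_prop)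
      continuousOn := ?_
      eq_one := fun p hp s hs => ?_
      eq_zero := fun p hp s hs => ?_ }⟩
  · have h1 : ContinuousOn (fun q : (ℝ × ℝ) × ℝ => δ q.1) (phaseRegion a b c ×ˢ univ) :=
      hδc.comp continuous_fst.continuousOn fun q hq => hq.1
    exact Real.smoothTransition.continuous.comp_continuousOn
      ((continuousOn_const.sub ((continuous_snd.continuousOn.div h1
        fun q hq => (hpos _ hq.1).ne').pow 2)).mul continuousOn_const)
  · refine Real.smoothTransition.one_of_one_le ?_
    have h1 : (s / δ p) ^ 2 ≤ (1 / 2) ^ 2 := by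
      rw [← sq_abs, abs_div, abs_of_pos (hpos p hp)]
      have := hpos p hp
      refine pow_le_pow_left₀ (by positivity) ?_ 2
      rw [div_le_iff₀ this]
      linarith
    linarith
  · refine Real.smoothTransition.zero_of_nonpos ?_
    have h1 : 1 ^ 2 ≤ (s / δ p) ^ 2 := by
      rw [← sq_abs (s / δ p), abs_div, abs_of_pos (hpos p hp)]
      gcongr
      rwa [le_div_iff₀ (hpos p hp), one_mul]
    linarith

end Cutoff

/-! ### Pointwise comparison of pseudo-eigenfunction and Gaussian. -/

section Estimate

/-- Mean value inequality on the convex half-plane `Re ≤ m`, where `|exp| ≤ exp m`. -/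
theorem norm_exp_sub_exp_le {z w : ℂ} {m : ℝ} (hz : z.re ≤ m) (hw : w.re ≤ m) :
    ‖Complex.exp z - Complex.exp w‖ ≤ ‖z - w‖ * Real.exp m := by
  rw [mul_comm]
  refine (convex_halfSpace_re_le m).norm_image_sub_le_of_norm_hasDerivWithin_le
    (fun x _ => (Complex.hasDerivAt_exp x).hasDerivWithinAt) (fun x hx => ?_) hw hz
  rw [Complex.norm_exp]
  exact Real.exp_le_exp.2 hx

/-- Half of the Gaussian decay is spent absorbing the polynomial: `y + y³ ≤ (1 + y²)²`, and each
factor `1 + y²` costs `exp(κ y² / 4)`. -/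
theorem add_cube_mul_exp_le {κ y : ℝ} (hκ : 0 < κ) :
    (y + y ^ 3) * Real.exp (-(κ * y ^ 2))
      ≤ (1 + 4 / κ) ^ 2 * Real.exp (-(κ / 2 * y ^ 2)) := by
  have h1 : y + y ^ 3 ≤ (1 + y ^ 2) ^ 2 := by
    nlinarith [sq_nonneg (y - 1), mul_nonneg (sq_nonneg y) (sq_nonneg (y - 1)), sq_nonneg y,
      sq_nonneg (y ^ 2)]
  have h2 : 1 + y ^ 2 ≤ (1 + 4 / κ) * Real.exp (κ / 4 * y ^ 2) := by
    calc 1 + y ^ 2 ≤ (1 + 4 / κ) * (κ / 4 * y ^ 2 + 1) := by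
          have e : (1 + 4 / κ) * (κ / 4 * y ^ 2 + 1) = 1 + y ^ 2 + (κ / 4 * y ^ 2 + 4 / κ) := by
            field_simp
            ring
          rw [e]
          have : 0 ≤ κ / 4 * y ^ 2 + 4 / κ := by positivity
          linarith
      _ ≤ _ := by gcongr; exact Real.add_one_le_exp _
  calc (y + y ^ 3) * Real.exp (-(κ * y ^ 2))
      ≤ ((1 + 4 / κ) * Real.exp (κ / 4 * y ^ 2)) ^ 2 * Real.exp (-(κ * y ^ 2)) := by
        gcongr
        exact h1.trans (by gcongr)
    _ = (1 + 4 / κ) ^ 2 * (Real.exp (κ / 4 * y ^ 2) ^ 2 * Real.exp (-(κ * y ^ 2))) := by ring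
    _ = _ := by
        rw [← Real.exp_nat_mul, ← Real.exp_add]
        congr 2
        push_cast
        ring

variable {a b c : ℝ → ℂ} {δ : ℝ × ℝ → ℝ} {χ : ℝ × ℝ → ℝ → ℝ}

theorem IsCutoff.mem_wkbDomain (hχ : IsCutoff a b c δ χ) {p : ℝ × ℝ}
    (hp : p ∈ phaseRegion a b c) {s : ℝ} (hs : |s| ≤ δ p) : (p, s) ∈ wkbDomain a b c :=
  mem_wkbDomain_of_abs_le (hχ.w_ne_zero p hp) hs

/-- The tube is the continuous image of `K × [-1, 1]` under scaling by `δ`. -/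
theorem IsCutoff.isCompact_tube (hχ : IsCutoff a b c δ χ) {K : Set (ℝ × ℝ)} (hK : IsCompact K)
    (hKΩ : K ⊆ phaseRegion a b c) :
    IsCompact {q : (ℝ × ℝ) × ℝ | q.1 ∈ K ∧ |q.2| ≤ δ q.1} := by
  have h : {q : (ℝ × ℝ) × ℝ | q.1 ∈ K ∧ |q.2| ≤ δ q.1}
      = (fun r : (ℝ × ℝ) × ℝ => (r.1, r.2 * δ r.1)) '' (K ×ˢ Icc (-1 : ℝ) 1) := by
    ext ⟨p, s⟩
    constructor
    · rintro ⟨hp, hs⟩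
      have hpos := hχ.radius_pos p (hKΩ hp)
      refine ⟨(p, s / δ p), ⟨hp, abs_le.1 ?_⟩, ?_⟩
      · rw [abs_div, abs_of_pos hpos]
        exact div_le_one_of_le₀ hs hpos.le
      · simp only
        rw [div_mul_cancel₀ _ hpos.ne']
    · rintro ⟨⟨p', t⟩, ⟨hp, ht⟩, heq⟩
      obtain ⟨rfl, rfl⟩ := Prod.mk.inj heq
      have hpos := hχ.radius_pos p' (hKΩ hp)
      refine ⟨hp, ?_⟩
      simp only
      rw [abs_mul, abs_of_pos hpos]
      exact mul_le_of_le_one_left hpos.le (abs_le.2 ht)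
  rw [h]
  refine (hK.prod isCompact_Icc).image_of_continuousOn ?_
  have hδ : ContinuousOn (fun q : (ℝ × ℝ) × ℝ => δ q.1) (K ×ˢ Icc (-1 : ℝ) 1) :=
    hχ.radius_continuousOn.comp continuous_fst.continuousOn fun q hq => hKΩ hq.1
  exact continuous_fst.continuousOn.prodMk (continuous_snd.continuousOn.mul hδ)

/-- Apart from the leading term, only nonnegative powers of `h ≤ 1` occur, and each `ψ_m` is
`O(|s|)`. -/
theorem exists_norm_wkbPhase_sub_le (ha : ContDiff ℝ ∞ a) (hb : ContDiff ℝ ∞ b)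
    (hc : ContDiff ℝ ∞ c) (ha0 : ∀ x, a x ≠ 0) {S : Set ((ℝ × ℝ) × ℝ)} (hSc : IsCompact S)
    (hSD : S ⊆ wkbDomain a b c) (hS : ∀ q ∈ S, ∀ t ∈ Icc (0 : ℝ) 1, (q.1, t * q.2) ∈ S) (N : ℕ) :
    ∃ B : ℝ, 0 ≤ B ∧ ∀ h : ℝ, 0 < h → h ≤ 1 → ∀ q ∈ S,
      ‖wkbPhase a b c N h q.1 q.2 - (h : ℂ)⁻¹ * wkbTerm a b c q.1 0 q.2‖ ≤ B * |q.2| := by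
  choose C hC0 hC using exists_norm_wkbTerm_le ha hb hc ha0 hSc hSD hS
  refine ⟨∑ j ∈ Finset.range N, C (j + 1), Finset.sum_nonneg fun j _ => hC0 _, ?_⟩
  intro h hh hh1 q hq
  rw [wkbPhase, Finset.sum_range_succ', Finset.sum_mul]
  have e0 : (h : ℂ) ^ (((0 : ℕ) : ℤ) - 1) = (h : ℂ)⁻¹ := by simp
  rw [e0, add_sub_cancel_right]
  refine norm_sum_le_of_le _ fun j _ => ?_
  have e1 : (((j + 1 : ℕ) : ℤ) - 1) = (j : ℤ) := by push_cast; ring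
  rw [e1, zpow_natCast, norm_mul, norm_pow, Complex.norm_real, Real.norm_of_nonneg hh.le]
  exact (mul_le_of_le_one_left (norm_nonneg _) (pow_le_one₀ hh.le hh1)).trans (hC _ q hq)

theorem gaussianState_re_exponent (h : ℝ) (p : ℝ × ℝ) (s : ℝ) :
    ((h : ℂ)⁻¹ * (Complex.I * p.2 * (s : ℂ) + gaussianCoeff a b c p * (s : ℂ) ^ 2 / 2)).re
      = h⁻¹ * ((gaussianCoeff a b c p).re / 2 * s ^ 2) := by
  rw [← Complex.ofReal_pow, ← Complex.ofReal_inv, Complex.re_ofReal_mul]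
  congr 1
  simp [-Complex.ofReal_pow]
  ring

theorem exists_norm_pseudoEigenfunction_sub_le (ha : ContDiff ℝ ∞ a) (hb : ContDiff ℝ ∞ b)
    (hc : ContDiff ℝ ∞ c) (ha0 : ∀ x, a x ≠ 0) (hχ : IsCutoff a b c δ χ) (N : ℕ)
    {K : Set (ℝ × ℝ)} (hK : IsCompact K) (hKΩ : K ⊆ phaseRegion a b c) :
    ∃ C κ : ℝ, 0 ≤ C ∧ 0 < κ ∧ ∀ h : ℝ, 0 < h → h ≤ 1 → ∀ p ∈ K, ∀ x : ℝ,
      ‖pseudoEigenfunction a b c χ N h p x - gaussianState a b c h p x‖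
        ≤ C * √h * (h ^ (-(1 / 4) : ℝ) * Real.exp (-(κ * (x - p.1) ^ 2 / h))) := by
  set S := {q : (ℝ × ℝ) × ℝ | q.1 ∈ K ∧ |q.2| ≤ δ q.1} with hSdef
  have hSc : IsCompact S := hχ.isCompact_tube hK hKΩ
  have hSD : S ⊆ wkbDomain a b c := fun q hq => hχ.mem_wkbDomain (hKΩ hq.1) hq.2
  have hS : ∀ q ∈ S, ∀ t ∈ Icc (0 : ℝ) 1, (q.1, t * q.2) ∈ S := fun q hq t ht => by
    refine ⟨hq.1, ?_⟩
    simp only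
    rw [abs_mul, abs_of_nonneg ht.1]
    exact (mul_le_of_le_one_left (abs_nonneg _) ht.2).trans hq.2
  have hSΩ : ∀ q ∈ S, q.1 ∈ phaseRegion a b c := fun q hq => hKΩ hq.1
  obtain ⟨κ, hκ, hκS⟩ := exists_eikonal_re_le_of_neg ha hb hc ha0 hSc hSD hS hSΩ
    fun q hq h0 => hχ.phase_neg q.1 (hKΩ hq.1) q.2 h0 hq.2
  obtain ⟨C₀, hC₀, hC₀S⟩ := exists_norm_eikonal_sub_le ha hb hc ha0 hSc hSD hS hSΩ
  obtain ⟨B, hB, hBS⟩ := exists_norm_wkbPhase_sub_le ha hb hc ha0 hSc hSD hS N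
  obtain ⟨M, hMS⟩ := hSc.exists_bound_of_continuousOn
    (hχ.continuousOn.mono fun q hq => ⟨hSΩ q hq, mem_univ _⟩)
  obtain ⟨R, hR⟩ := hSc.exists_bound_of_continuousOn (f := fun q : (ℝ × ℝ) × ℝ => q.2)
    continuous_snd.continuousOn
  obtain ⟨d, hd, hdK⟩ := hK.exists_forall_le' (hχ.radius_continuousOn.mono hKΩ) (a := 0)
    fun p hp => hχ.radius_pos p (hKΩ hp)
  set M' := max M 0
  -- The first summand serves `|s| ≤ δ/2`, where `χ = 1` and the exponents are compared; the second
  -- serves the rest, where both functions are small. `M'` bounds `|χ|`, since a cutoff need not lie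
  -- in `[0, 1]`, and `exp(B|R|)` bounds the effect of `ψ_m`, `m ≥ 0`.
  set Q := (C₀ + B) * Real.exp (B * |R|) + (M' * Real.exp (B * |R|) + 1) / (d / 2) with hQ
  have hM'0 : 0 ≤ M' := le_max_right _ _
  have hQ0 : 0 ≤ Q := by positivity
  refine ⟨Q * (1 + 4 / κ) ^ 2, κ / 2, by positivity, by positivity, ?_⟩
  intro h hh hh1 p hp x
  set s := x - p.1 with hs
  have hh' : 0 < √h := Real.sqrt_pos.2 hh
  obtain ⟨t, ht⟩ : ∃ t, t = |s| / √h := ⟨_, rfl⟩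
  have ht0 : 0 ≤ t := by rw [ht]; positivity
  have hst : |s| = √h * t := by rw [ht]; field_simp
  have hst2 : s ^ 2 = h * t ^ 2 := by rw [← sq_abs, hst, mul_pow, Real.sq_sqrt hh.le]
  have hst3 : h⁻¹ * |s| ^ 3 = √h * t ^ 3 := by
    rw [pow_succ, sq_abs, hst2, hst]
    field_simp
  set A := wkbPhase a b c N h p s
  set G : ℂ := (h : ℂ)⁻¹ * (Complex.I * p.2 * (s : ℂ) + gaussianCoeff a b c p * (s : ℂ) ^ 2 / 2)
  -- The Gaussian must be bounded for all `x`, also outside the tube; the bound on `Re k` is read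
  -- off at `(p, 0)`.
  have hp0 : (p, (0 : ℝ)) ∈ S := ⟨hp, by simpa using (hχ.radius_pos p (hKΩ hp)).le⟩
  have hG : G.re ≤ -(κ * t ^ 2) := by
    rw [gaussianState_re_exponent, hst2]
    have := mul_le_mul_of_nonneg_right (hκS _ hp0).1 (sq_nonneg t)
    have e : h⁻¹ * ((gaussianCoeff a b c p).re / 2 * (h * t ^ 2))
        = (gaussianCoeff a b c p).re / 2 * t ^ 2 := by field_simp
    rw [e]
    simpa using this
  have hA : |s| ≤ δ p → A.re ≤ -(κ * t ^ 2) + B * |R| ∧ ‖A - G‖ ≤ √h * ((C₀ + B) * (t + t ^ 3)) :=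
    fun hsδ => by
    have hmem : (p, s) ∈ S := ⟨hp, hsδ⟩
    have h1 : ‖A - (h : ℂ)⁻¹ * wkbTerm a b c p 0 s‖ ≤ B * |s| := hBS h hh hh1 (p, s) hmem
    have h2 : (wkbTerm a b c p 0 s).re ≤ -κ * s ^ 2 := (hκS (p, s) hmem).2
    have h3 : ‖wkbTerm a b c p 0 s - (Complex.I * p.2 * s
        + gaussianCoeff a b c p * (s : ℂ) ^ 2 / 2)‖ ≤ C₀ * |s| ^ 3 := hC₀S (p, s) hmem
    have h4 : |s| ≤ |R| := (hR (p, s) hmem).trans (le_abs_self R)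
    have h5 : ((h : ℂ)⁻¹ * wkbTerm a b c p 0 s).re ≤ -(κ * t ^ 2) := by
      rw [← Complex.ofReal_inv, Complex.re_ofReal_mul]
      calc h⁻¹ * (wkbTerm a b c p 0 s).re ≤ h⁻¹ * (-κ * s ^ 2) := by gcongr
        _ = -(κ * t ^ 2) := by rw [hst2]; field_simp
    constructor
    · have h6 := (Complex.re_le_norm _).trans h1
      rw [Complex.sub_re] at h6
      have h7 : B * |s| ≤ B * |R| := by gcongr
      linarith
    · have h8 : ‖(h : ℂ)⁻¹ * wkbTerm a b c p 0 s - G‖ ≤ C₀ * (√h * t ^ 3) := by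
        rw [← mul_sub, norm_mul, norm_inv, Complex.norm_real, Real.norm_of_nonneg hh.le, ← hst3]
        calc h⁻¹ * _ ≤ h⁻¹ * (C₀ * |s| ^ 3) := by gcongr
          _ = _ := by ring
      have h9 : √h * (C₀ * t ^ 3 + B * t) ≤ √h * ((C₀ + B) * (t + t ^ 3)) := by
        gcongr
        nlinarith [mul_nonneg hC₀ ht0, mul_nonneg hB (pow_nonneg ht0 3)]
      calc ‖A - G‖ ≤ B * |s| + C₀ * (√h * t ^ 3) :=
            (norm_sub_le_norm_sub_add_norm_sub _ _ _).trans (add_le_add h1 h8)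
        _ = √h * (C₀ * t ^ 3 + B * t) := by rw [hst]; ring
        _ ≤ _ := h9
  have hE : ∀ y, Real.exp (-(κ * t ^ 2) + y) = Real.exp y * Real.exp (-(κ * t ^ 2)) := fun y => by
    rw [Real.exp_add, mul_comm]
  have hmain : ‖(χ p s : ℂ) * Complex.exp A - Complex.exp G‖
      ≤ √h * (Q * ((t + t ^ 3) * Real.exp (-(κ * t ^ 2)))) := by
    have ht3 : 0 ≤ t ^ 3 := by positivity
    have hGn : ‖Complex.exp G‖ ≤ Real.exp (-(κ * t ^ 2)) := by
      rw [Complex.norm_exp]; exact Real.exp_le_exp.2 hG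
    rcases le_or_gt |s| (δ p / 2) with hsd | hsd
    · have hδ := hχ.radius_pos p (hKΩ hp)
      obtain ⟨hA1, hA2⟩ := hA (by linarith)
      rw [hχ.eq_one p (hKΩ hp) s hsd, Complex.ofReal_one, one_mul]
      refine (norm_exp_sub_exp_le hA1 (hG.trans (by
        have : 0 ≤ B * |R| := by positivity
        linarith))).trans ?_
      rw [hE]
      calc ‖A - G‖ * (Real.exp (B * |R|) * Real.exp (-(κ * t ^ 2)))
          ≤ √h * ((C₀ + B) * (t + t ^ 3)) * (Real.exp (B * |R|) * Real.exp (-(κ * t ^ 2))) := by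
            gcongr
        _ = √h * ((C₀ + B) * Real.exp (B * |R|) * ((t + t ^ 3) * Real.exp (-(κ * t ^ 2)))) := by
            ring
        _ ≤ _ := by
            gcongr
            rw [hQ]
            exact le_add_of_nonneg_right (by positivity)
    · have h1 : ‖(χ p s : ℂ) * Complex.exp A‖
          ≤ M' * Real.exp (B * |R|) * Real.exp (-(κ * t ^ 2)) := by
        rcases le_or_gt |s| (δ p) with hsδ | hsδ
        · rw [norm_mul, Complex.norm_real, Complex.norm_exp, mul_assoc, ← hE]
          gcongr
          · exact (hMS (p, s) ⟨hp, hsδ⟩).trans (le_max_left _ _)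
          · exact (hA hsδ).1
        · rw [hχ.eq_zero p (hKΩ hp) s hsδ.le]
          simp only [Complex.ofReal_zero, zero_mul, norm_zero]
          positivity
      -- Here `√h t = |s| > d/2`, so the missing factor `√h` is bought with a power of `t`.
      have h2 : 1 ≤ √h * (t + t ^ 3) / (d / 2) := by
        rw [le_div_iff₀ (by positivity), one_mul]
        have := hdK p hp
        have h3 : 0 ≤ √h * t ^ 3 := by positivity
        rw [mul_add, ← hst]
        linarith
      calc _ ≤ M' * Real.exp (B * |R|) * Real.exp (-(κ * t ^ 2)) + Real.exp (-(κ * t ^ 2)) :=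
            (norm_sub_le _ _).trans (add_le_add h1 hGn)
        _ = (M' * Real.exp (B * |R|) + 1) * Real.exp (-(κ * t ^ 2)) * 1 := by ring
        _ ≤ (M' * Real.exp (B * |R|) + 1) * Real.exp (-(κ * t ^ 2))
            * (√h * (t + t ^ 3) / (d / 2)) := by gcongr
        _ = √h * ((M' * Real.exp (B * |R|) + 1) / (d / 2)
            * ((t + t ^ 3) * Real.exp (-(κ * t ^ 2)))) := by ring
        _ ≤ _ := by
            gcongr
            rw [hQ]
            exact le_add_of_nonneg_left (by positivity)
  have hpow : 0 ≤ h ^ (-(1 / 4) : ℝ) := Real.rpow_nonneg hh.le _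
  have hfac : pseudoEigenfunction a b c χ N h p x - gaussianState a b c h p x
      = ((h ^ (-(1 / 4) : ℝ) : ℝ) : ℂ) * ((χ p s : ℂ) * Complex.exp A - Complex.exp G) := by
    simp only [pseudoEigenfunction, gaussianState]
    ring
  have hexp : κ / 2 * s ^ 2 / h = κ / 2 * t ^ 2 := by rw [hst2]; field_simp
  rw [hfac, norm_mul, Complex.norm_real, Real.norm_of_nonneg hpow, hexp]
  calc h ^ (-(1 / 4) : ℝ) * ‖(χ p s : ℂ) * Complex.exp A - Complex.exp G‖
      ≤ h ^ (-(1 / 4) : ℝ) * (√h * (Q * ((1 + 4 / κ) ^ 2 * Real.exp (-(κ / 2 * t ^ 2))))) := by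
        gcongr
        refine hmain.trans ?_
        gcongr √h * (Q * ?_)
        exact add_cube_mul_exp_le hκ
    _ = _ := by ring

end Estimate

/-! ### `L²` norms of the Gaussians. -/

section GaussianNorm

/-- The prefactor `h^{-1/4}` squares to `(√h)⁻¹` and cancels the width of the Gaussian, so the norm
does not depend on `h`. -/
theorem eLpNorm_gaussian_profile {h κ : ℝ} (hh : 0 < h) (hκ : 0 < κ) (u : ℝ) :
    eLpNorm (fun x : ℝ => ((h ^ (-(1 / 4) : ℝ) * Real.exp (-(κ * (x - u) ^ 2 / h)) : ℝ) : ℂ)) 2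
      volume = ENNReal.ofReal √√(Real.pi / (2 * κ)) := by
  have hb : 0 < 2 * κ / h := by positivity
  have hpow : (h ^ (-(1 / 4) : ℝ)) ^ 2 = (√h)⁻¹ := by
    rw [← Real.rpow_natCast, ← Real.rpow_mul hh.le, Real.sqrt_eq_rpow, ← Real.rpow_neg hh.le]
    norm_num
  have hpt : ∀ x : ℝ,
      ‖((h ^ (-(1 / 4) : ℝ) * Real.exp (-(κ * (x - u) ^ 2 / h)) : ℝ) : ℂ)‖ₑ ^ 2
        = ENNReal.ofReal ((√h)⁻¹ * Real.exp (-(2 * κ / h) * (x - u) ^ 2)) := fun x => by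
    rw [← ofReal_norm, Complex.norm_real, Real.norm_of_nonneg (by positivity),
      ← ENNReal.ofReal_pow (by positivity), mul_pow, hpow, ← Real.exp_nat_mul]
    congr 3
    push_cast
    ring
  have hsq : eLpNorm (fun x : ℝ =>
      ((h ^ (-(1 / 4) : ℝ) * Real.exp (-(κ * (x - u) ^ 2 / h)) : ℝ) : ℂ)) 2 volume ^ 2
        = ENNReal.ofReal √√(Real.pi / (2 * κ)) ^ 2 := by
    rw [eLpNorm_two_sq, ← ENNReal.ofReal_pow (by positivity), Real.sq_sqrt (by positivity)]
    simp only [hpt]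
    rw [← ofReal_integral_eq_lintegral_ofReal]
    · congr 1
      rw [integral_const_mul, integral_sub_right_eq_self
        (fun x : ℝ => Real.exp (-(2 * κ / h) * x ^ 2)) u, integral_gaussian,
        ← div_eq_inv_mul, ← Real.sqrt_div' _ hh.le]
      congr 1
      field_simp
    · exact ((integrable_exp_neg_mul_sq hb).comp_sub_right u).const_mul _
    · exact Eventually.of_forall fun x => by positivity
  exact le_antisymm ((ENNReal.pow_le_pow_left_iff two_ne_zero).1 hsq.le)
    ((ENNReal.pow_le_pow_left_iff two_ne_zero).1 hsq.ge)

variable {a b c : ℝ → ℂ}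

theorem norm_gaussianState (h : ℝ) (hh : 0 < h) (p : ℝ × ℝ) (x : ℝ) :
    ‖gaussianState a b c h p x‖ = h ^ (-(1 / 4) : ℝ)
      * Real.exp (-(-(gaussianCoeff a b c p).re / 2 * (x - p.1) ^ 2 / h)) := by
  rw [gaussianState, norm_mul, Complex.norm_real, Real.norm_of_nonneg (Real.rpow_nonneg hh.le _),
    Complex.norm_exp, gaussianState_re_exponent]
  congr 2
  ring

theorem eLpNorm_gaussianState (ha : ContDiff ℝ ∞ a) (hb : ContDiff ℝ ∞ b) (hc : ContDiff ℝ ∞ c)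
    {h : ℝ} (hh : 0 < h) {p : ℝ × ℝ} (hp : p ∈ phaseRegion a b c) :
    eLpNorm (gaussianState a b c h p) 2 volume
      = ENNReal.ofReal √√(Real.pi / -(gaussianCoeff a b c p).re) := by
  have hk := gaussianCoeff_re_neg ha hb hc hp
  have h1 := eLpNorm_gaussian_profile hh (κ := -(gaussianCoeff a b c p).re / 2) (by linarith) p.1
  rw [mul_div_cancel₀ _ two_ne_zero] at h1
  rw [← h1]
  refine eLpNorm_congr_norm_ae (Eventually.of_forall fun x => ?_)
  rw [norm_gaussianState h hh, Complex.norm_real, Real.norm_of_nonneg (by positivity)]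

theorem eLpNorm_gaussianState_ne_zero (ha : ContDiff ℝ ∞ a) (hb : ContDiff ℝ ∞ b)
    (hc : ContDiff ℝ ∞ c) {h : ℝ} (hh : 0 < h) {p : ℝ × ℝ} (hp : p ∈ phaseRegion a b c) :
    eLpNorm (gaussianState a b c h p) 2 volume ≠ 0 := by
  rw [eLpNorm_gaussianState ha hb hc hh hp]
  have hk := neg_pos.2 (gaussianCoeff_re_neg ha hb hc hp)
  have := Real.pi_pos
  exact (ENNReal.ofReal_pos.2 (by positivity)).ne'

theorem memLp_gaussianState (ha : ContDiff ℝ ∞ a) (hb : ContDiff ℝ ∞ b) (hc : ContDiff ℝ ∞ c)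
    {h : ℝ} (hh : 0 < h) {p : ℝ × ℝ} (hp : p ∈ phaseRegion a b c) :
    MemLp (gaussianState a b c h p) 2 volume := by
  refine ⟨Continuous.aestronglyMeasurable ?_, ?_⟩
  · unfold gaussianState
    fun_prop
  · rw [eLpNorm_gaussianState ha hb hc hh hp]
    exact ENNReal.ofReal_lt_top

end GaussianNorm

/-! ### Joint continuity, measurability, and `L²` estimates of the normalized states. -/

section Continuity

variable {a b c : ℝ → ℂ} {δ : ℝ × ℝ → ℝ} {χ : ℝ × ℝ → ℝ → ℝ}

theorem continuousOn_gaussianState (ha : ContDiff ℝ ∞ a) (hb : ContDiff ℝ ∞ b)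
    (hc : ContDiff ℝ ∞ c) (h : ℝ) :
    ContinuousOn (fun q : (ℝ × ℝ) × ℝ => gaussianState a b c h q.1 q.2)
      (phaseRegion a b c ×ˢ univ) := by
  have hk : ContinuousOn (fun q : (ℝ × ℝ) × ℝ => gaussianCoeff a b c q.1)
      (phaseRegion a b c ×ˢ univ) :=
    (continuousOn_gaussianCoeff ha hb hc).comp continuous_fst.continuousOn fun q hq => hq.1
  unfold gaussianState
  fun_prop

/-- The phase is controlled only on `wkbDomain`. This open set contains the closed tube `|s| ≤ δ`,
and outside the tube the function vanishes locally because of the cutoff. -/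
theorem continuousOn_pseudoEigenfunction (ha : ContDiff ℝ ∞ a) (hb : ContDiff ℝ ∞ b)
    (hc : ContDiff ℝ ∞ c) (ha0 : ∀ x, a x ≠ 0) (hχ : IsCutoff a b c δ χ) (N : ℕ) (h : ℝ) :
    ContinuousOn (fun q : (ℝ × ℝ) × ℝ => pseudoEigenfunction a b c χ N h q.1 q.2)
      (phaseRegion a b c ×ˢ univ) := by
  have hO : IsOpen (phaseRegion a b c ×ˢ (univ : Set ℝ)) :=
    (isOpen_phaseRegion ha hb hc).prod isOpen_univ
  have hsh : Continuous fun q : (ℝ × ℝ) × ℝ => (q.1, q.2 - q.1.1) := by fun_prop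
  intro q hq
  obtain ⟨p, x⟩ := q
  have hp : p ∈ phaseRegion a b c := (mem_prod.1 hq).1
  refine ContinuousAt.continuousWithinAt ?_
  have hχ' : ContinuousAt (fun q : (ℝ × ℝ) × ℝ => χ q.1 q.2) (p, x - p.1) :=
    hχ.continuousOn.continuousAt (hO.mem_nhds (mk_mem_prod hp (mem_univ _)))
  have hχc : ContinuousAt (fun q : (ℝ × ℝ) × ℝ => χ q.1 (q.2 - q.1.1)) (p, x) :=
    hχ'.comp_of_eq (f := fun q : (ℝ × ℝ) × ℝ => (q.1, q.2 - q.1.1)) hsh.continuousAt rfl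
  rcases le_or_gt |x - p.1| (δ p) with hs | hs
  · have hmem : (p, x - p.1) ∈ wkbDomain a b c := hχ.mem_wkbDomain hp hs
    have hph' : ContinuousAt (fun q : (ℝ × ℝ) × ℝ => wkbPhase a b c N h q.1 q.2) (p, x - p.1) :=
      (continuousOn_wkbPhase ha hb hc ha0 N h).continuousAt
        ((isOpen_wkbDomain ha hb hc ha0).mem_nhds hmem)
    have hph : ContinuousAt (fun q : (ℝ × ℝ) × ℝ => wkbPhase a b c N h q.1 (q.2 - q.1.1)) (p, x) :=
      hph'.comp_of_eq (f := fun q : (ℝ × ℝ) × ℝ => (q.1, q.2 - q.1.1)) hsh.continuousAt rfl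
    exact (continuousAt_const.mul (Complex.continuous_ofReal.continuousAt.comp hχc)).mul hph.cexp
  · have hδ' : ContinuousAt δ p :=
      hχ.radius_continuousOn.continuousAt ((isOpen_phaseRegion ha hb hc).mem_nhds hp)
    have hδ : ContinuousAt (fun q : (ℝ × ℝ) × ℝ => δ q.1) (p, x) :=
      hδ'.comp_of_eq (f := fun q : (ℝ × ℝ) × ℝ => q.1) continuousAt_fst rfl
    have hab : ContinuousAt (fun q : (ℝ × ℝ) × ℝ => |q.2 - q.1.1|) (p, x) := by fun_prop
    have hev : (fun q : (ℝ × ℝ) × ℝ => pseudoEigenfunction a b c χ N h q.1 q.2) =ᶠ[𝓝 (p, x)]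
        fun _ => 0 := by
      filter_upwards [hδ.eventually_lt hab hs, hO.mem_nhds hq] with r hr hrO
      rw [pseudoEigenfunction, hχ.eq_zero r.1 (mem_prod.1 hrO).1 _ hr.le]
      simp
    exact continuousAt_const.congr hev.symm

theorem aestronglyMeasurable_normalized {Ω U : Set (ℝ × ℝ)} (hU : MeasurableSet U)
    (hUΩ : U ⊆ Ω) {f : ℝ × ℝ → ℝ → ℂ}
    (hf : ContinuousOn (fun q : (ℝ × ℝ) × ℝ => f q.1 q.2) (Ω ×ˢ univ)) :
    AEStronglyMeasurable (Function.uncurry fun p => normalized (f p))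
      ((volume.restrict U).prod volume) := by
  have hfm : AEStronglyMeasurable (Function.uncurry f) ((volume.restrict U).prod volume) := by
    have h1 : ((volume.restrict U).prod volume : Measure ((ℝ × ℝ) × ℝ))
        = ((volume : Measure (ℝ × ℝ)).prod (volume : Measure ℝ)).restrict (U ×ˢ univ) := by
      rw [← Measure.prod_restrict, Measure.restrict_univ]
    rw [h1]
    exact (hf.mono (prod_mono hUΩ Subset.rfl)).aestronglyMeasurable (hU.prod MeasurableSet.univ)
  have h2 : AEMeasurable (fun q : (ℝ × ℝ) × ℝ => (((eLpNorm (f q.1) 2 volume).toReal : ℝ) : ℂ))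
      ((volume.restrict U).prod volume) :=
    Complex.measurable_ofReal.comp_aemeasurable
      (aemeasurable_eLpNorm_kernel hfm).ennreal_toReal.comp_fst
  exact (hfm.aemeasurable.div h2).aestronglyMeasurable

theorem continuous_of_continuousOn_prod {Ω : Set (ℝ × ℝ)} {f : ℝ × ℝ → ℝ → ℂ}
    (hf : ContinuousOn (fun q : (ℝ × ℝ) × ℝ => f q.1 q.2) (Ω ×ˢ univ)) {p : ℝ × ℝ} (hp : p ∈ Ω) :
    Continuous (f p) :=
  hf.comp_continuous (f := fun x : ℝ => (p, x)) (by fun_prop) fun _ => ⟨hp, mem_univ _⟩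

theorem exists_eLpNorm_normalized_sub_le (ha : ContDiff ℝ ∞ a) (hb : ContDiff ℝ ∞ b)
    (hc : ContDiff ℝ ∞ c) (ha0 : ∀ x, a x ≠ 0) (hχ : IsCutoff a b c δ χ) (N : ℕ)
    {K : Set (ℝ × ℝ)} (hK : IsCompact K) (hKΩ : K ⊆ phaseRegion a b c) :
    ∃ C : ℝ, 0 ≤ C ∧ ∀ h : ℝ, 0 < h → h ≤ 1 → ∀ p ∈ K,
      eLpNorm (fun x => normalized (pseudoEigenfunction a b c χ N h p) x
        - normalized (gaussianState a b c h p) x) 2 volume ≤ ENNReal.ofReal (C * √h) := by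
  obtain ⟨C, κ, hC, hκ, hCK⟩ := exists_norm_pseudoEigenfunction_sub_le ha hb hc ha0 hχ N hK hKΩ
  obtain ⟨R, hR⟩ := hK.exists_bound_of_continuousOn ((continuousOn_gaussianCoeff ha hb hc).mono hKΩ)
  have hpi := Real.pi_pos
  -- A lower bound for the Gaussian norms over `K`, since `-Re k ≤ |R| + 1` there.
  set L := √√(Real.pi / (|R| + 1))
  have hL : 0 < L := by positivity
  refine ⟨2 * (C * √√(Real.pi / (2 * κ))) / L, by positivity, fun h hh hh1 p hp => ?_⟩
  have hg := memLp_gaussianState ha hb hc hh (hKΩ hp)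
  have hfc := continuous_of_continuousOn_prod
    (continuousOn_pseudoEigenfunction ha hb hc ha0 hχ N h) (hKΩ hp)
  have hdiff : eLpNorm (pseudoEigenfunction a b c χ N h p - gaussianState a b c h p) 2 volume
      ≤ ENNReal.ofReal (C * √h * √√(Real.pi / (2 * κ))) := by
    rw [ENNReal.ofReal_mul (by positivity), ← eLpNorm_gaussian_profile hh hκ p.1]
    refine eLpNorm_le_mul_eLpNorm_of_ae_le_mul (Eventually.of_forall fun x => ?_) 2
    rw [Complex.norm_real, Real.norm_of_nonneg (by positivity)]
    exact hCK h hh hh1 p hp x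
  have hfg : MemLp (pseudoEigenfunction a b c χ N h p - gaussianState a b c h p) 2 volume :=
    ⟨hfc.aestronglyMeasurable.sub hg.1, hdiff.trans_lt ENNReal.ofReal_lt_top⟩
  have hf : MemLp (pseudoEigenfunction a b c χ N h p) 2 volume := by simpa using hfg.add hg
  refine (eLpNorm_normalized_sub_le hf hg
    (eLpNorm_gaussianState_ne_zero ha hb hc hh (hKΩ hp))).trans (ENNReal.ofReal_le_ofReal ?_)
  have h1 : (eLpNorm (pseudoEigenfunction a b c χ N h p - gaussianState a b c h p) 2
      volume).toReal ≤ C * √h * √√(Real.pi / (2 * κ)) :=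
    ENNReal.toReal_le_of_le_ofReal (by positivity) hdiff
  have h2 : L ≤ (eLpNorm (gaussianState a b c h p) 2 volume).toReal := by
    rw [eLpNorm_gaussianState ha hb hc hh (hKΩ hp), ENNReal.toReal_ofReal (by positivity)]
    have hk := neg_pos.2 (gaussianCoeff_re_neg ha hb hc (hKΩ hp))
    have hk2 : -(gaussianCoeff a b c p).re ≤ |R| + 1 := by
      have h3 := (Complex.abs_re_le_norm _).trans ((hR p hp).trans (le_abs_self R))
      linarith [neg_le_abs (gaussianCoeff a b c p).re]
    exact Real.sqrt_le_sqrt (Real.sqrt_le_sqrt (div_le_div_of_nonneg_left hpi.le hk hk2))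
  calc _ ≤ 2 * (C * √h * √√(Real.pi / (2 * κ))) / L := by gcongr
    _ = _ := by ring

/-- Dominated convergence in `x`: near `p₀` all the states lie under one wider Gaussian centred at
`p₀.1`. -/
theorem tendsto_eLpNorm_gaussianState_sub (ha : ContDiff ℝ ∞ a) (hb : ContDiff ℝ ∞ b)
    (hc : ContDiff ℝ ∞ c) {h : ℝ} (hh : 0 < h) {p₀ : ℝ × ℝ} (hp₀ : p₀ ∈ phaseRegion a b c) :
    Tendsto (fun p => eLpNorm (gaussianState a b c h p - gaussianState a b c h p₀) 2 volume)
      (𝓝 p₀) (𝓝 0) := by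
  have hΩ := isOpen_phaseRegion ha hb hc
  have hk₀ := gaussianCoeff_re_neg ha hb hc hp₀
  obtain ⟨κ, hκ, hκ₀⟩ : ∃ κ : ℝ, 0 < κ ∧ (gaussianCoeff a b c p₀).re / 2 < -κ :=
    ⟨-(gaussianCoeff a b c p₀).re / 4, by linarith, by linarith⟩
  have hkc : ContinuousAt (fun p => (gaussianCoeff a b c p).re / 2) p₀ :=
    (Complex.continuous_re.continuousAt.comp
      ((continuousOn_gaussianCoeff ha hb hc).continuousAt (hΩ.mem_nhds hp₀))).div_const 2
  -- If `|u - u₀| < 1` then `(x - u₀)²/2 ≤ (x - u)² + 1`: moving the centre halves the decay rate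
  -- and costs the factor `exp(κ/h)`, harmless because `h` is fixed.
  have hev : ∀ᶠ p in 𝓝 p₀, ∀ x : ℝ, ‖gaussianState a b c h p x‖ ≤ Real.exp (κ / h)
      * (h ^ (-(1 / 4) : ℝ) * Real.exp (-(κ / 2 * (x - p₀.1) ^ 2 / h))) := by
    have hu : ∀ᶠ p : ℝ × ℝ in 𝓝 p₀, |p.1 - p₀.1| < 1 := by
      have : ContinuousAt (fun p : ℝ × ℝ => |p.1 - p₀.1|) p₀ := by fun_prop
      exact this.eventually_lt continuousAt_const (by simp)
    filter_upwards [hkc.eventually_lt continuousAt_const hκ₀, hu] with p hp hpu x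
    rw [norm_gaussianState h hh, mul_left_comm, ← Real.exp_add]
    gcongr
    have h1 : (p.1 - p₀.1) ^ 2 ≤ 1 := by
      rw [← sq_abs]; exact pow_le_one₀ (abs_nonneg _) hpu.le
    have h2 : (x - p₀.1) ^ 2 / 2 ≤ (x - p.1) ^ 2 + 1 := by
      nlinarith [sq_nonneg ((x - p.1) - (p.1 - p₀.1))]
    have h3 : -(-(gaussianCoeff a b c p).re / 2 * (x - p.1) ^ 2) ≤ κ - κ / 2 * (x - p₀.1) ^ 2 := by
      have h4 := mul_le_mul_of_nonneg_right hp.le (sq_nonneg (x - p.1))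
      have h5 := mul_le_mul_of_nonneg_left h2 hκ.le
      linarith
    calc -(-(gaussianCoeff a b c p).re / 2 * (x - p.1) ^ 2 / h)
        = -(-(gaussianCoeff a b c p).re / 2 * (x - p.1) ^ 2) / h := by ring
      _ ≤ (κ - κ / 2 * (x - p₀.1) ^ 2) / h := by gcongr
      _ = _ := by ring
  set Γ : ℝ → ℂ := fun x =>
    ((h ^ (-(1 / 4) : ℝ) * Real.exp (-(κ / 2 * (x - p₀.1) ^ 2 / h)) : ℝ) : ℂ) with hΓ
  have hΓn : ∀ x, ‖Γ x‖ = h ^ (-(1 / 4) : ℝ) * Real.exp (-(κ / 2 * (x - p₀.1) ^ 2 / h)) :=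
    fun x => by rw [hΓ, Complex.norm_real, Real.norm_of_nonneg (by positivity)]
  have hΓfin : ∫⁻ x, ‖((2 * Real.exp (κ / h) : ℝ) : ℂ) * Γ x‖ₑ ^ 2 ≠ ⊤ := by
    rw [← eLpNorm_two_sq]
    refine ENNReal.pow_ne_top ?_
    have h1 : eLpNorm (fun x => ((2 * Real.exp (κ / h) : ℝ) : ℂ) * Γ x) 2 volume
        = ‖((2 * Real.exp (κ / h) : ℝ) : ℂ)‖ₑ * eLpNorm Γ 2 volume :=
      eLpNorm_const_smul ((2 * Real.exp (κ / h) : ℝ) : ℂ) Γ 2 volume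
    rw [h1, eLpNorm_gaussian_profile hh (half_pos hκ)]
    exact ENNReal.mul_ne_top enorm_ne_top ENNReal.ofReal_ne_top
  have hcont := continuousOn_gaussianState ha hb hc h
  have hlim : Tendsto (fun p => ∫⁻ x, ‖gaussianState a b c h p x - gaussianState a b c h p₀ x‖ₑ ^ 2)
      (𝓝 p₀) (𝓝 (∫⁻ _ : ℝ, 0)) := by
    refine tendsto_lintegral_filter_of_dominated_convergence
      (fun x => ‖((2 * Real.exp (κ / h) : ℝ) : ℂ) * Γ x‖ₑ ^ 2) ?_ ?_ hΓfin ?_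
    · filter_upwards [hΩ.mem_nhds hp₀] with p hp
      have h1 := (continuous_of_continuousOn_prod hcont hp).sub
        (continuous_of_continuousOn_prod hcont hp₀)
      exact (h1.measurable.enorm.pow_const 2)
    · filter_upwards [hev] with p hp
      refine Eventually.of_forall fun x => ?_
      gcongr
      rw [enorm_le_iff_norm_le, norm_mul, Complex.norm_real, Real.norm_of_nonneg (by positivity),
        hΓn]
      have h1 := norm_sub_le (gaussianState a b c h p x) (gaussianState a b c h p₀ x)
      have h2 := hp x
      have h3 := hev.self_of_nhds x
      linarith
    · refine Eventually.of_forall fun x => ?_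
      have h1 : ContinuousAt (fun p => gaussianState a b c h p x) p₀ :=
        ContinuousAt.comp (g := fun q : (ℝ × ℝ) × ℝ => gaussianState a b c h q.1 q.2)
          (f := fun p : ℝ × ℝ => (p, x))
          (hcont.continuousAt ((hΩ.prod isOpen_univ).mem_nhds ⟨hp₀, mem_univ x⟩)) (by fun_prop)
      have h2 : ContinuousAt
          (fun p => ‖gaussianState a b c h p x - gaussianState a b c h p₀ x‖ₑ ^ 2) p₀ :=
        (ENNReal.continuous_pow 2).continuousAt.comp
          (continuous_enorm.continuousAt.comp (h1.sub continuousAt_const))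
      simpa [ContinuousAt] using h2
  rw [lintegral_zero] at hlim
  have h2 := ((ENNReal.continuous_rpow_const (y := (1 / 2 : ℝ))).tendsto 0).comp hlim
  rw [ENNReal.zero_rpow_of_pos (by norm_num)] at h2
  refine h2.congr fun p => ?_
  simp only [Function.comp]
  have h3 : ∫⁻ x, ‖gaussianState a b c h p x - gaussianState a b c h p₀ x‖ₑ ^ 2
      = eLpNorm (gaussianState a b c h p - gaussianState a b c h p₀) 2 volume ^ 2 :=
    (eLpNorm_two_sq volume _).symm
  rw [h3, ← ENNReal.rpow_natCast, ← ENNReal.rpow_mul]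
  norm_num

theorem tendsto_eLpNorm_normalized_gaussianState_sub (ha : ContDiff ℝ ∞ a) (hb : ContDiff ℝ ∞ b)
    (hc : ContDiff ℝ ∞ c) {h : ℝ} (hh : 0 < h) {p₀ : ℝ × ℝ} (hp₀ : p₀ ∈ phaseRegion a b c) :
    Tendsto (fun p => eLpNorm (fun x => normalized (gaussianState a b c h p) x
      - normalized (gaussianState a b c h p₀) x) 2 volume) (𝓝 p₀) (𝓝 0) := by
  have h1 := ((ENNReal.tendsto_toReal ENNReal.zero_ne_top).comp
    (tendsto_eLpNorm_gaussianState_sub ha hb hc hh hp₀))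
  have h2 := ENNReal.tendsto_ofReal ((h1.const_mul 2).div_const
    (eLpNorm (gaussianState a b c h p₀) 2 volume).toReal)
  simp only [ENNReal.toReal_zero, mul_zero, zero_div, ENNReal.ofReal_zero] at h2
  refine tendsto_of_tendsto_of_tendsto_of_le_of_le' tendsto_const_nhds h2
    (Eventually.of_forall fun _ => zero_le) ?_
  filter_upwards [(isOpen_phaseRegion ha hb hc).mem_nhds hp₀] with p hp
  exact eLpNorm_normalized_sub_le (memLp_gaussianState ha hb hc hh hp)
    (memLp_gaussianState ha hb hc hh hp₀) (eLpNorm_gaussianState_ne_zero ha hb hc hh hp₀)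

end Continuity

/-! ### Operator norms and limits of transforms. -/

section Limits

variable {U : Set (ℝ × ℝ)}

theorem IsIntegralTransform.norm_tendsto_zero {e e' : ℝ → ℝ × ℝ → ℝ → ℂ}
    {T T' : ℝ → Lp ℂ 1 (volume.restrict U) →L[ℂ] Lp ℂ 2 (volume : Measure ℝ)}
    (hU : MeasurableSet U)
    (hT : ∀ h, 0 < h → IsIntegralTransform U (e h) (T h))
    (hT' : ∀ h, 0 < h → IsIntegralTransform U (e' h) (T' h))
    (he : ∀ h, 0 < h →
      AEStronglyMeasurable (Function.uncurry (e h)) ((volume.restrict U).prod volume))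
    (he' : ∀ h, 0 < h →
      AEStronglyMeasurable (Function.uncurry (e' h)) ((volume.restrict U).prod volume))
    {C : ℝ} (hC : 0 ≤ C)
    (hle : ∀ h, 0 < h → h ≤ 1 → ∀ p ∈ U,
      eLpNorm (fun x => e h p x - e' h p x) 2 volume ≤ ENNReal.ofReal (C * √h)) :
    Tendsto (fun h => ‖T h - T' h‖) (𝓝[>] 0) (𝓝 0) := by
  have hlim : Tendsto (fun h : ℝ => C * √h) (𝓝[>] 0) (𝓝 0) := by
    have h1 : Continuous fun h : ℝ => C * √h := by fun_prop
    have h2 := h1.tendsto 0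
    simp only [Real.sqrt_zero, mul_zero] at h2
    exact h2.mono_left nhdsWithin_le_nhds
  refine squeeze_zero' (Eventually.of_forall fun _ => norm_nonneg _) ?_ hlim
  filter_upwards [Ioc_mem_nhdsGT (zero_lt_one' ℝ)] with h hh
  refine ((hT h hh.1).sub (hT' h hh.1)).norm_le ((he h hh.1).sub (he' h hh.1)) (by positivity) ?_
  filter_upwards [ae_restrict_mem hU] with p hp using hle h hh.1 hh.2 p hp

theorem IsIntegralTransform.norm_apply_tendsto_zero {e e' : ℝ → ℝ × ℝ → ℝ → ℂ}
    {T T' : ℝ → Lp ℂ 1 (volume.restrict U) →L[ℂ] Lp ℂ 2 (volume : Measure ℝ)}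
    (hU : MeasurableSet U)
    (hT : ∀ h, 0 < h → IsIntegralTransform U (e h) (T h))
    (hT' : ∀ h, 0 < h → IsIntegralTransform U (e' h) (T' h))
    (he : ∀ h, 0 < h →
      AEStronglyMeasurable (Function.uncurry (e h)) ((volume.restrict U).prod volume))
    (he' : ∀ h, 0 < h →
      AEStronglyMeasurable (Function.uncurry (e' h)) ((volume.restrict U).prod volume))
    {M : ENNReal} (hM : M ≠ ⊤)
    (hbd : ∀ h, 0 < h → ∀ p ∈ U, eLpNorm (fun x => e h p x - e' h p x) 2 volume ≤ M)
    (hlim : ∀ p ∈ U,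
      Tendsto (fun h => eLpNorm (fun x => e h p x - e' h p x) 2 volume) (𝓝[>] 0) (𝓝 0))
    (φ : Lp ℂ 1 (volume.restrict U)) :
    Tendsto (fun h => ‖T h φ - T' h φ‖) (𝓝[>] 0) (𝓝 0) := by
  have hφ : AEMeasurable (fun p => ‖φ p‖ₑ) (volume.restrict U) :=
    (Lp.aestronglyMeasurable φ).enorm
  have hφfin : ∫⁻ p in U, ‖φ p‖ₑ ≠ ⊤ := by
    rw [← eLpNorm_one_eq_lintegral_enorm, ← Lp.enorm_def]
    exact enorm_ne_top
  have h1 : Tendsto (fun h => ∫⁻ p in U, ‖φ p‖ₑ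
      * eLpNorm (fun x => e h p x - e' h p x) 2 volume ^ 2) (𝓝[>] 0)
      (𝓝 (∫⁻ _ in U, 0)) := by
    refine tendsto_lintegral_filter_of_dominated_convergence' (fun p => ‖φ p‖ₑ * M ^ 2) ?_ ?_ ?_ ?_
    · filter_upwards [self_mem_nhdsWithin] with h hh
      exact hφ.mul ((aemeasurable_eLpNorm_kernel ((he h hh).sub (he' h hh))).pow_const 2)
    · filter_upwards [self_mem_nhdsWithin] with h hh
      filter_upwards [ae_restrict_mem hU] with p hp
      gcongr
      exact hbd h hh p hp
    · rw [lintegral_mul_const'' _ hφ]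
      exact ENNReal.mul_ne_top hφfin (ENNReal.pow_ne_top hM)
    · filter_upwards [ae_restrict_mem hU] with p hp
      have h2 := ((ENNReal.continuous_pow 2).tendsto 0).comp (hlim p hp)
      have h3 := ENNReal.Tendsto.const_mul (a := ‖φ p‖ₑ) h2 (Or.inr enorm_ne_top)
      simpa using h3
  rw [lintegral_zero] at h1
  have h2 := ENNReal.Tendsto.const_mul (a := ‖φ‖ₑ) h1 (Or.inr enorm_ne_top)
  rw [mul_zero] at h2
  have h3 : Tendsto (fun h => ‖T h φ - T' h φ‖ₑ ^ 2) (𝓝[>] 0) (𝓝 0) := by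
    refine tendsto_of_tendsto_of_tendsto_of_le_of_le' tendsto_const_nhds h2
      (Eventually.of_forall fun _ => zero_le) ?_
    filter_upwards [self_mem_nhdsWithin] with h hh
    exact ((hT h hh).sub (hT' h hh)).enorm_sq_le ((he h hh).sub (he' h hh)) φ
  have h4 := ((Real.continuous_sqrt.tendsto 0).comp
    ((ENNReal.tendsto_toReal ENNReal.zero_ne_top).comp h3))
  rw [Real.sqrt_zero] at h4
  refine h4.congr fun h => ?_
  simp [Function.comp, Real.sqrt_sq]

/-- Tested on the indicator of a small ball of mass `m` around `p₀`, the transform differs by at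
most `ε m` from `m • e p₀`, whose norm is exactly `m`. -/
theorem IsIntegralTransform.one_le_norm {e : ℝ × ℝ → ℝ → ℂ}
    {T : Lp ℂ 1 (volume.restrict U) →L[ℂ] Lp ℂ 2 (volume : Measure ℝ)} (hU : IsOpen U)
    (hT : IsIntegralTransform U e T)
    (he : AEStronglyMeasurable (Function.uncurry e) ((volume.restrict U).prod volume))
    {p₀ : ℝ × ℝ} (hp₀ : p₀ ∈ U) (he₀ : MemLp (e p₀) 2 volume)
    (h1 : eLpNorm (e p₀) 2 volume = 1)
    (hlim : Tendsto (fun p => eLpNorm (fun x => e p x - e p₀ x) 2 volume) (𝓝 p₀) (𝓝 0)) :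
    1 ≤ ‖T‖ := by
  refine le_of_forall_pos_le_add fun ε hε => ?_
  have hev : ∀ᶠ p in 𝓝 p₀, eLpNorm (fun x => e p x - e p₀ x) 2 volume ≤ ENNReal.ofReal ε :=
    (hlim.eventually_lt_const (ENNReal.ofReal_pos.2 hε)).mono fun _ h => h.le
  obtain ⟨r, hr, hrB⟩ := Metric.mem_nhds_iff.1 (hev.and (hU.mem_nhds hp₀))
  set B := Metric.ball p₀ r
  have hBU : B ⊆ U := fun p hp => (hrB hp).2
  have hBm : MeasurableSet B := measurableSet_ball
  have hμB : volume.restrict U B = volume B := by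
    rw [Measure.restrict_apply hBm, inter_eq_left.2 hBU]
  have hBt : volume.restrict U B ≠ ⊤ := by
    rw [hμB]; exact measure_ball_lt_top.ne
  set φ : Lp ℂ 1 (volume.restrict U) := indicatorConstLp 1 hBm hBt (1 : ℂ) with hφ
  set m : ℝ := (volume.restrict U B).toReal with hm
  have hm0 : 0 < m := ENNReal.toReal_pos
    (by rw [hμB]; exact (Metric.measure_ball_pos volume p₀ hr).ne') hBt
  have hφn : ‖φ‖ = m := by
    rw [hφ, norm_indicatorConstLp one_ne_zero ENNReal.one_ne_top]
    simp [hm, Measure.real]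
  have hφi : ∫ p in U, φ p = (m : ℂ) := by
    rw [integral_congr_ae indicatorConstLp_coeFn, integral_indicator_const _ hBm]
    simp [hm, Measure.real]
  have he₀m : AEStronglyMeasurable (Function.uncurry fun _ : ℝ × ℝ => e p₀)
      ((volume.restrict U).prod volume) := he₀.1.comp_snd
  -- The transform with constant kernel `e p₀` makes `T φ - m • e p₀` itself an integral transform,
  -- to which the weighted bound applies.
  obtain ⟨T₀, hT₀⟩ := exists_isIntegralTransform (U := U) (e := fun _ => e p₀) he₀m (M := 1)
    (Eventually.of_forall fun _ => by simp [h1])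
  have hT₀φ : ‖T₀ φ‖ = m := by
    have h2 : T₀ φ =ᵐ[volume] (m : ℂ) • e p₀ := by
      filter_upwards [hT₀ φ] with x hx
      rw [hx.2, integral_mul_const, hφi, Pi.smul_apply, smul_eq_mul]
    rw [Lp.norm_def, eLpNorm_congr_ae h2, eLpNorm_const_smul, h1, mul_one, toReal_enorm,
      Complex.norm_real, Real.norm_of_nonneg hm0.le]
  have hdiff : ‖T φ - T₀ φ‖ ≤ ε * m := by
    have h2 := (hT.sub hT₀).enorm_sq_le (he.sub he₀m) φ
    have h3 : ∫⁻ p in U, ‖φ p‖ₑ * eLpNorm (fun x => e p x - e p₀ x) 2 volume ^ 2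
        ≤ ∫⁻ p in U, ‖φ p‖ₑ * ENNReal.ofReal ε ^ 2 := by
      refine lintegral_mono_ae ?_
      -- The kernels need to be close only on the ball, since `φ` vanishes off it.
      filter_upwards [indicatorConstLp_coeFn (p := 1) (hs := hBm) (hμs := hBt) (c := (1 : ℂ))]
        with p hp
      by_cases hpB : p ∈ B
      · gcongr
        exact (hrB hpB).1
      · rw [← hφ] at hp
        rw [hp, indicator_of_notMem hpB]
        simp
    have h4 : ‖T φ - T₀ φ‖ₑ ^ 2 ≤ (ENNReal.ofReal ε * ‖φ‖ₑ) ^ 2 := by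
      refine h2.trans ((mul_le_mul_right h3 _).trans_eq ?_)
      rw [lintegral_mul_const'' _ (Lp.aestronglyMeasurable φ).enorm,
        ← eLpNorm_one_eq_lintegral_enorm, ← Lp.enorm_def]
      ring
    have h5 := (ENNReal.pow_le_pow_left_iff two_ne_zero).1 h4
    rw [← ofReal_norm, ← ofReal_norm, ← ENNReal.ofReal_mul hε.le, hφn] at h5
    exact (ENNReal.ofReal_le_ofReal_iff (by positivity)).1 h5
  have hop := T.le_opNorm φ
  rw [hφn] at hop
  have h6 : m ≤ (‖T‖ + ε) * m := by
    have h7 := norm_sub_norm_le (T₀ φ) (T φ)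
    rw [norm_sub_rev, hT₀φ] at h7
    linarith
  exact le_of_mul_le_mul_right (by rwa [one_mul]) hm0

end Limits

end Semiclassical

/-! ### Assembly of the theorem. -/

open Semiclassical in
theorem mainTheorem6 (a b c : ℝ → ℂ) (ha : ContDiff ℝ ∞ a) (hb : ContDiff ℝ ∞ b)
    (hc : ContDiff ℝ ∞ c) (ha0 : ∀ x, a x ≠ 0) :
    (∀ h : ℝ, 0 < h → ∀ p ∈ Semiclassical.phaseRegion a b c,
        MemLp (Semiclassical.gaussianState a b c h p) 2 volume) ∧
    (∃ δ χ, Semiclassical.IsCutoff a b c δ χ) ∧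
    ∀ (δ : ℝ × ℝ → ℝ) (χ : ℝ × ℝ → ℝ → ℝ), Semiclassical.IsCutoff a b c δ χ → ∀ N : ℕ,
      ∃ E E' : (U : Set (ℝ × ℝ)) → ℝ →
          (Lp ℂ 1 (volume.restrict U) →L[ℂ] Lp ℂ 2 (volume : Measure ℝ)),
        (∀ U : Set (ℝ × ℝ), MeasurableSet U → U ⊆ Semiclassical.phaseRegion a b c →
          ∀ h : ℝ, 0 < h →
            Semiclassical.IsIntegralTransform U
              (fun p => Semiclassical.normalized
                (Semiclassical.pseudoEigenfunction a b c χ N h p)) (E U h) ∧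
            Semiclassical.IsIntegralTransform U
              (fun p => Semiclassical.normalized
                (Semiclassical.gaussianState a b c h p)) (E' U h)) ∧
        ((Semiclassical.phaseRegion a b c).Nonempty →
          ∀ h : ℝ, 0 < h → ‖E' (Semiclassical.phaseRegion a b c) h‖ = 1) ∧
        (∀ φ : Lp ℂ 1 (volume.restrict (Semiclassical.phaseRegion a b c)),
          Tendsto (fun h : ℝ => ‖E (Semiclassical.phaseRegion a b c) h φ
              - E' (Semiclassical.phaseRegion a b c) h φ‖) (𝓝[>] 0) (𝓝 0)) ∧
        (∀ U : Set (ℝ × ℝ), IsCompact U → U ⊆ Semiclassical.phaseRegion a b c →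
          Tendsto (fun h : ℝ => ‖E U h - E' U h‖) (𝓝[>] 0) (𝓝 0)) := by
  refine ⟨fun h hh p hp => memLp_gaussianState ha hb hc hh hp, exists_isCutoff ha hb hc ha0,
    fun δ χ hχ N => ?_⟩
  have hΩ : IsOpen (phaseRegion a b c) := isOpen_phaseRegion ha hb hc
  have hm : ∀ (U : Set (ℝ × ℝ)), MeasurableSet U → U ⊆ phaseRegion a b c → ∀ h : ℝ,
      AEStronglyMeasurable (Function.uncurry fun p =>
        normalized (pseudoEigenfunction a b c χ N h p)) ((volume.restrict U).prod volume) :=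
    fun U hU hUΩ h => aestronglyMeasurable_normalized hU hUΩ
      (continuousOn_pseudoEigenfunction ha hb hc ha0 hχ N h)
  have hm' : ∀ (U : Set (ℝ × ℝ)), MeasurableSet U → U ⊆ phaseRegion a b c → ∀ h : ℝ,
      AEStronglyMeasurable (Function.uncurry fun p =>
        normalized (gaussianState a b c h p)) ((volume.restrict U).prod volume) :=
    fun U hU hUΩ h => aestronglyMeasurable_normalized hU hUΩ (continuousOn_gaussianState ha hb hc h)
  -- The families are indexed by all sets `U`; the zero operator is the default when `U` is not a
  -- measurable subset of the region.
  have hex : ∀ (U : Set (ℝ × ℝ)) (h : ℝ), ∃ T T' : Lp ℂ 1 (volume.restrict U) →L[ℂ]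
      Lp ℂ 2 (volume : Measure ℝ), MeasurableSet U → U ⊆ phaseRegion a b c →
        IsIntegralTransform U (fun p => normalized (pseudoEigenfunction a b c χ N h p)) T ∧
        IsIntegralTransform U (fun p => normalized (gaussianState a b c h p)) T' := fun U h => by
    by_cases hU : MeasurableSet U ∧ U ⊆ phaseRegion a b c
    · obtain ⟨T, hT⟩ := exists_isIntegralTransform (hm U hU.1 hU.2 h) (M := 1)
        (Eventually.of_forall fun p => by simpa using eLpNorm_normalized_le_one _)
      obtain ⟨T', hT'⟩ := exists_isIntegralTransform (hm' U hU.1 hU.2 h) (M := 1)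
        (Eventually.of_forall fun p => by simpa using eLpNorm_normalized_le_one _)
      exact ⟨T, T', fun _ _ => ⟨hT, hT'⟩⟩
    · exact ⟨0, 0, fun h1 h2 => absurd ⟨h1, h2⟩ hU⟩
  choose E E' hE using hex
  refine ⟨E, E', fun U hU hUΩ h _ => hE U h hU hUΩ, ?_, ?_, ?_⟩
  · rintro ⟨p₀, hp₀⟩ h hh
    have hT := (hE _ h hΩ.measurableSet Subset.rfl).2
    have hmΩ := hm' _ hΩ.measurableSet Subset.rfl h
    have hg := memLp_gaussianState ha hb hc hh hp₀
    have h1 := eLpNorm_normalized_eq_one (eLpNorm_gaussianState_ne_zero ha hb hc hh hp₀) hg.2.ne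
    refine le_antisymm (hT.norm_le hmΩ zero_le_one (Eventually.of_forall fun p => ?_)) ?_
    · simpa using eLpNorm_normalized_le_one _
    · refine hT.one_le_norm hΩ hmΩ hp₀ ⟨?_, ?_⟩ h1
        (tendsto_eLpNorm_normalized_gaussianState_sub ha hb hc hh hp₀)
      · exact (hg.1.aemeasurable.div_const _).aestronglyMeasurable
      · rw [h1]; exact ENNReal.one_lt_top
  · intro φ
    refine IsIntegralTransform.norm_apply_tendsto_zero hΩ.measurableSet
      (fun h _ => (hE _ h hΩ.measurableSet Subset.rfl).1)
      (fun h _ => (hE _ h hΩ.measurableSet Subset.rfl).2)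
      (fun h _ => hm _ hΩ.measurableSet Subset.rfl h)
      -- The dominating constant 2 is the sum of two norms at most 1.
      (fun h _ => hm' _ hΩ.measurableSet Subset.rfl h) (M := 2) (by simp) ?_ ?_ φ
    · intro h hh p hp
      have hf := (continuous_of_continuousOn_prod
        (continuousOn_pseudoEigenfunction ha hb hc ha0 hχ N h) hp).div_const
          ((eLpNorm (pseudoEigenfunction a b c χ N h p) 2 volume).toReal : ℂ)
      have hg := (continuous_of_continuousOn_prod
        (continuousOn_gaussianState ha hb hc h) hp).div_const
          ((eLpNorm (gaussianState a b c h p) 2 volume).toReal : ℂ)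
      refine (eLpNorm_sub_le hf.aestronglyMeasurable hg.aestronglyMeasurable one_le_two).trans ?_
      exact (add_le_add (eLpNorm_normalized_le_one _)
        (eLpNorm_normalized_le_one _)).trans_eq one_add_one_eq_two
    · intro p hp
      -- Only convergence at each fixed `p` is needed, so the compact estimate is applied to the
      -- singleton `{p}`.
      obtain ⟨C, hC, hCK⟩ := exists_eLpNorm_normalized_sub_le ha hb hc ha0 hχ N
        (isCompact_singleton (x := p)) (singleton_subset_iff.2 hp)
      have hlim : Tendsto (fun h : ℝ => ENNReal.ofReal (C * √h)) (𝓝[>] 0) (𝓝 0) := by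
        have h1 : Continuous fun h : ℝ => ENNReal.ofReal (C * √h) :=
          ENNReal.continuous_ofReal.comp (by fun_prop)
        have h2 := h1.tendsto 0
        simp only [Real.sqrt_zero, mul_zero, ENNReal.ofReal_zero] at h2
        exact h2.mono_left nhdsWithin_le_nhds
      refine tendsto_of_tendsto_of_tendsto_of_le_of_le' tendsto_const_nhds hlim
        (Eventually.of_forall fun _ => zero_le) ?_
      filter_upwards [Ioc_mem_nhdsGT (zero_lt_one' ℝ)] with h hh
      exact hCK h hh.1 hh.2 p rfl
  · intro U hU hUΩ
    obtain ⟨C, hC, hCK⟩ := exists_eLpNorm_normalized_sub_le ha hb hc ha0 hχ N hU hUΩ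
    exact IsIntegralTransform.norm_tendsto_zero hU.measurableSet
      (fun h _ => (hE _ h hU.measurableSet hUΩ).1) (fun h _ => (hE _ h hU.measurableSet hUΩ).2)
      (fun h _ => hm _ hU.measurableSet hUΩ h) (fun h _ => hm' _ hU.measurableSet hUΩ h) hC hCK

end
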